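/- **Setting.** Let $k$ be an algebraically closed field and let $p$ be its characteristic exponent ($p=\operatorname{char}k$ if this is positive, and $p=1$ if $\operatorname{char}k=0$, so that every $p^{e}$ is then $1$). Let $R$ be either the localization at a maximal ideal of the coordinate ring of an affine open subset of a variety smooth over $k$, or the completion of such a local ring; let $\mathfrak m$ be the maximal ideal of $R$, with the convention $\mathfrak m^n=R$ for $n\le 0$, and let $G=\bigoplus_{n\ge 0}G_n=\bigoplus_{n\ge0}\mathfrak m^n/\mathfrak m^{n+1}$. A differential operator of degree $\le n$ on $R$ is a map $d:R\to R$ of the form $d(r)=\varphi(1\otimes r \bmod I^{n+1})$, where $I$ is the kernel of the multiplication map $R\otimes_kR\to R$ and $\varphi:(R\otimes_k R)/I^{n+1}\to R$ is $R$-linear for the $R$-structure given by the first factor. An idealistic filtration over $R$ is a subset $\mathbb I\subset R\times\mathbb R$ such that, with $\mathbb I_a=\{f\mid (f,a)\in\mathbb I\}$: every $\mathbb I_a$ is an ideal, $\mathbb I_0=R$, $\mathbb I_a\mathbb I_b\subset\mathbb I_{a+b}$, and $\mathbb I_a\subset\mathbb I_b$ whenever $b\le a$. It is $\mathfrak D$-saturated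 if $(f,a)\in\mathbb I$ implies $(d(f),a-t)\in\mathbb I$ for every integer $t\ge0$ and every differential operator $d$ of degree $\le t$. Let $\mathbb I$ be a $\mathfrak D$-saturated idealistic filtration over $R$, let $\mathcal H=\{h_1,\dots,h_N\}\subset R$, and let $0\le e_1\le\dots\le e_N$ be integers such that (i) $h_l\in\mathfrak m^{p^{e_l}}$, and $\overline{h_l}=(h_l \bmod \mathfrak m^{p^{e_l}+1})\in G_{p^{e_l}}$ is of the form $v^{p^{e_l}}$ with $v\in G_1$, for $l=1,\dots,N$; (ii) for every $s=1,\dots,N$, the elements $\overline{h_l}^{\,p^{e_s-e_l}}$ of $G_{p^{e_s}}$, indexed by the $l$ with $e_l\le e_s$, are distinct and linearly independent over $k$; (iii) $(h_l,p^{e_l})\in\mathbb I$ for $l=1,\dots,N$. Let $(\mathcal H)$ be the ideal generated by $\mathcal H$. For $f\in R$ set $\operatorname{ord}_{\mathcal H}(f)=\sup\{n\in\mathbb Z_{\ge0}\mid f\in\mathfrak m^n+(\mathcal H)\}\in\mathbb Z_{\ge 0}\cup\{\infty\}$, and set $$\mu_{\mathcal H}(\mathbb I)=\inf\Big\{\tfrac{\operatorname{ord}_{\mathcal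 H}(f)}{a}\ \Big|\ (f,a)\in\mathbb I,\ a>0\Big\}\in[0,\infty].$$ For $B=(b_1,\dots,b_N)\in\mathbb Z_{\ge0}^N$ write $|[B]|=\sum_{l=1}^N b_lp^{e_l}$ and $H^B=\prod_{l=1}^N h_l^{b_l}$. **Lemma (Coefficient Lemma).** Let $\mu\in\mathbb R$ with $0\le\mu<\mu_{\mathcal H}(\mathbb I)$, and put $\mathbb I'_t=\mathbb I_t\cap\mathfrak m^{\lceil\mu t\rceil}$ for $t\in\mathbb R$. Then for every $a\in\mathbb R$, $$\mathbb I_a=\sum_{B\in\mathbb Z_{\ge0}^N}\mathbb I'_{a-|[B]|}\,H^B .$$ -/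

import Mathlib

open scoped TensorProduct ENNReal

universe u v

namespace Kawanoue

/-! ### The local rings of the theory -/

/-- `R` is the localization, at a maximal ideal `M`, of the coordinate ring `A` of an affine open
subset of a variety smooth over `k`, i.e. of a domain `A` that is smooth over `k` (in particular of
finite type). -/
def IsLocalRingAtClosedPoint (k : Type u) (R : Type v) [Field k] [CommRing R] [Algebra k R] :
    Prop :=
  ∃ (A : Type v) (_ : CommRing A) (_ : IsDomain A) (_ : Algebra k A) (_ : Algebra.Smooth k A)
    (M : Ideal A) (_ : M.IsMaximal) (_ : Algebra A R) (_ : IsScalarTower k A R),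
    IsLocalization.AtPrime R M

/-- `R` is the completion, with respect to its maximal ideal, of a local ring as in
`IsLocalRingAtClosedPoint`. -/
def IsCompletedLocalRingAtClosedPoint (k : Type u) (R : Type v) [Field k] [CommRing R]
    [Algebra k R] : Prop :=
  ∃ (R₀ : Type v) (_ : CommRing R₀) (_ : IsLocalRing R₀) (_ : Algebra k R₀),
    IsLocalRingAtClosedPoint k R₀ ∧
      Nonempty (R ≃ₐ[k] AdicCompletion (IsLocalRing.maximalIdeal R₀) R₀)

/-! ### Differential operators -/

/-- The algebra of principal parts `P^n_R = (R ⊗[k] R) / I^(n+1)`, where `I` is the kernel of the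
multiplication map. It is an `R`-module through the first tensor factor. -/
abbrev PrincipalParts (k : Type u) (R : Type v) [Field k] [CommRing R] [Algebra k R] (n : ℕ) :
    Type v :=
  (R ⊗[k] R) ⧸ (KaehlerDifferential.ideal k R) ^ (n + 1)

/-- `d : R → R` is a differential operator of degree `≤ n` over `k`: it is the composite of
`r ↦ 1 ⊗ r mod I^(n+1)` with an `R`-linear map `P^n_R → R`. -/
def IsDiffOp (k : Type u) {R : Type v} [Field k] [CommRing R] [Algebra k R] (n : ℕ)
    (d : R → R) : Prop :=
  ∃ φ : PrincipalParts k R n →ₗ[R] R,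
    ∀ r : R, d r = φ (Ideal.Quotient.mk _ ((1 : R) ⊗ₜ[k] r))

/-! ### Idealistic filtrations -/

/-- An idealistic filtration over `R`, given by its ideals `level a` (`a ∈ ℝ`); as a subset of
`R × ℝ` it is `{(f, a) | f ∈ level a}`. -/
structure IdealisticFiltration (R : Type v) [CommRing R] where
  level : ℝ → Ideal R
  level_zero : level 0 = ⊤
  level_mul_le : ∀ a b : ℝ, level a * level b ≤ level (a + b)
  level_antitone : ∀ a b : ℝ, b ≤ a → level a ≤ level b

/-- `𝔇`-saturation: a differential operator of degree `≤ t` maps level `a` into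
level `a - t`. -/
def IdealisticFiltration.IsDSaturated (k : Type u) {R : Type v} [Field k] [CommRing R]
    [Algebra k R] (I : IdealisticFiltration R) : Prop :=
  ∀ (a : ℝ) (f : R) (t : ℕ) (d : R → R),
    f ∈ I.level a → IsDiffOp k t d → d f ∈ I.level (a - t)

/-! ### The associated graded ring -/

/-- The ideal `⊕ J^(n+1)` of the Rees algebra `⊕ J^n`. -/
def reesShift {R : Type v} [CommRing R] (J : Ideal R) : Ideal (reesAlgebra J) where
  carrier := {f | ∀ n, (f : Polynomial R).coeff n ∈ J ^ (n + 1)}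
  zero_mem' := fun n => by simp
  add_mem' := fun {f g} hf hg n => by
    simpa using (J ^ (n + 1)).add_mem (hf n) (hg n)
  smul_mem' := fun c f hf n => by
    have h : ((c • f : reesAlgebra J) : Polynomial R) = (c : Polynomial R) * f := rfl
    rw [h, Polynomial.coeff_mul]
    refine Ideal.sum_mem _ fun x hx => ?_
    have hx2 : x.1 + x.2 = n := Finset.HasAntidiagonal.mem_antidiagonal.mp hx
    rw [← hx2, add_assoc, pow_add]
    exact Ideal.mul_mem_mul (c.2 x.1) (hf x.2)

/-- The associated graded ring `⊕ J^n / J^(n+1)`, as the quotient of `⊕ J^n` by `⊕ J^(n+1)`. -/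
abbrev Gr {R : Type v} [CommRing R] (J : Ideal R) : Type v :=
  reesAlgebra J ⧸ reesShift J

/-- The class `f mod J^(n+1)` of `f ∈ J^n` in degree `n` of the associated graded ring. -/
noncomputable def grClass {R : Type v} [CommRing R] (J : Ideal R) (n : ℕ) (f : R) (hf : f ∈ J ^ n) : Gr J :=
  Ideal.Quotient.mk (reesShift J)
    ⟨Polynomial.monomial n f, reesAlgebra.monomial_mem.mpr hf⟩

theorem grClass_eq_zero_iff {R : Type v} [CommRing R] (J : Ideal R) (n : ℕ) (f : R)
    (hf : f ∈ J ^ n) : grClass J n f hf = 0 ↔ f ∈ J ^ (n + 1) := by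
  rw [grClass, Ideal.Quotient.eq_zero_iff_mem]
  constructor
  · intro h
    have h2 : (Polynomial.monomial n f).coeff n ∈ J ^ (n + 1) := h n
    rwa [Polynomial.coeff_monomial, if_pos rfl] at h2
  · intro h m
    change (Polynomial.monomial n f).coeff m ∈ J ^ (m + 1)
    rw [Polynomial.coeff_monomial]
    split_ifs with hnm
    · subst hnm
      exact h
    · exact Ideal.zero_mem _

/-- The pure part in degree `p^e` of the associated graded ring `G`: the image `F^e(G_1)` of the
degree-one part `G_1` under `v ↦ v^(p^e)`. -/
def purePart {R : Type v} [CommRing R] (J : Ideal R) (p e : ℕ) : Set (Gr J) :=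
  {w | ∃ (x : R) (hx : x ∈ J ^ 1), w = grClass J 1 x hx ^ p ^ e}

/-! ### The set `ℋ = {h_1, …, h_N}` and its invariants -/

/-- Conditions (i) and (ii) on `h_1, …, h_N` with exponents `e_1 ≤ ⋯ ≤ e_N`; here `p` is the
characteristic exponent of `k`. A linearly independent family is in particular injective. -/
structure IsPureSystem (k : Type u) {R : Type v} [Field k] [CommRing R] [IsLocalRing R]
    [Algebra k R] (p : ℕ) {N : ℕ} (h : Fin N → R) (e : Fin N → ℕ) : Prop where
  mono : Monotone e
  mem : ∀ l, h l ∈ IsLocalRing.maximalIdeal R ^ p ^ e l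
  pure : ∀ l, grClass (IsLocalRing.maximalIdeal R) (p ^ e l) (h l) (mem l) ∈
    purePart (IsLocalRing.maximalIdeal R) p (e l)
  linearIndependent : ∀ s, LinearIndependent k fun l : {l : Fin N // e l ≤ e s} =>
    grClass (IsLocalRing.maximalIdeal R) (p ^ e l.1) (h l.1) (mem l.1) ^ p ^ (e s - e l.1)

/-- `ord_ℋ(f) = sup {n ∈ ℕ | f ∈ 𝔪^n + (ℋ)}`. -/
noncomputable def ordMod {R : Type v} [CommRing R] [IsLocalRing R] {N : ℕ} (h : Fin N → R)
    (f : R) : ℕ∞ :=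
  sSup {m : ℕ∞ | ∃ n : ℕ, m = n ∧
    f ∈ IsLocalRing.maximalIdeal R ^ n ⊔ Ideal.span (Set.range h)}

/-- `μ_ℋ(𝕀) = inf {ord_ℋ(f) / a | (f, a) ∈ 𝕀, a > 0}`, in `[0, ∞]`. -/
noncomputable def muMod {R : Type v} [CommRing R] [IsLocalRing R] {N : ℕ} (h : Fin N → R)
    (I : IdealisticFiltration R) : ℝ≥0∞ :=
  sInf {x : ℝ≥0∞ | ∃ (f : R) (a : ℝ), f ∈ I.level a ∧ 0 < a ∧
    x = (ordMod h f : ℝ≥0∞) / ENNReal.ofReal a}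

/-- `𝕀'_t = 𝕀_t ∩ 𝔪^⌈μt⌉`, with `𝔪^n = R` for `n ≤ 0` (the ceiling `⌈·⌉₊` is `0` on
nonpositive numbers). -/
noncomputable def cutLevel {R : Type v} [CommRing R] [IsLocalRing R] (I : IdealisticFiltration R)
    (μ t : ℝ) : Ideal R :=
  I.level t ⊓ IsLocalRing.maximalIdeal R ^ ⌈μ * t⌉₊

/-- `|[B]| = ∑ b_l p^(e_l)`. -/
def weight (p : ℕ) {N : ℕ} (e : Fin N → ℕ) (B : Fin N → ℕ) : ℕ :=
  ∑ l, B l * p ^ e l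

end Kawanoue

/-! Choose `y l` in the maximal ideal with h_l ≡ y_l^{p^{e_l}} modulo order p^{e_l}+1, and complete
them to coordinates x of R. Replacing in x^J the largest power of each y_l^{p^{e_l}} by the same
power of h_l gives a normal monomial x^rem · H^quot with leading form x^J. Those of degree r span
𝔪^r modulo 𝔪^{r+1} (`mem_span_normalMono`), they are independent (`coeff_eq_zero`), and those free
of h stay independent modulo (ℋ) (`eq_zero_of_mem_sup`).

Let f ∈ 𝕀_a have a leading form of degree r, and let B have maximal total degree among its
h-exponents. A composite D of differential operators, of total degree |[B]|, acts on leading forms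
as the divided-power derivative with exponents b_l p^{e_l}. It kills the terms whose h-exponent is
not B and, by Lucas, sends x^rem H^B to x^rem. So Df lies in 𝕀_{a-|[B]|}, and its leading form is
the coefficient of H^B. As this is free of h, the condition on μ forces either Df ∈ 𝕀'_{a-|[B]|} or
a zero coefficient. Subtracting Df · H^B removes the terms with exponent B, and repetition pushes f
into the sum plus 𝔪^{r+1} (`mem_iSup_sup`). Krull's intersection theorem concludes.

Divided-power derivatives come from Hasse–Schmidt derivations, which lift tangent vectors by formal
smoothness and pass to completions by continuity. `IsHasseSmooth` collects all that is needed about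
R. -/

namespace Kawanoue

/-! ### Hasse–Schmidt derivations as differential operators -/

/-- A Hasse–Schmidt derivation of length `n` over `k`: the coefficient maps of a truncated
deformation `r ↦ ∑ D j r T ^ j` of the identity that is multiplicative modulo `T ^ (n + 1)`. -/
structure IsHasseSchmidt (k : Type u) {R : Type v} [Field k] [CommRing R] [Algebra k R] (n : ℕ)
    (D : ℕ → R →ₗ[k] R) : Prop where
  zero : ∀ f, D 0 f = f
  leibniz : ∀ j ≤ n, ∀ f g, D j (f * g) = ∑ ij ∈ Finset.HasAntidiagonal.antidiagonal j, D ij.1 f * D ij.2 g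

namespace IsHasseSchmidt

variable {k : Type u} {R : Type v} [Field k] [CommRing R] [Algebra k R] {n : ℕ}
  {D : ℕ → R →ₗ[k] R}

theorem leibniz_succ (hD : IsHasseSchmidt k n D) {j : ℕ} (hj : j + 1 ≤ n) (f g : R) :
    D (j + 1) (f * g) =
      f * D (j + 1) g + ∑ ij ∈ Finset.HasAntidiagonal.antidiagonal j, D (ij.1 + 1) f * D ij.2 g := by
  rw [hD.leibniz _ hj, Finset.Nat.antidiagonal_succ]
  simp [hD.zero]

theorem liftBaseChange_mul (hD : IsHasseSchmidt k n D) {j : ℕ} (hj : j ≤ n) (r : R)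
    (w : R ⊗[k] R) : (D j).liftBaseChange R ((1 ⊗ₜ r) * w) =
      ∑ ij ∈ Finset.HasAntidiagonal.antidiagonal j, D ij.1 r * (D ij.2).liftBaseChange R w := by
  induction w with
  | zero => simp
  | add x y hx hy => simp only [mul_add, map_add, hx, hy, Finset.sum_add_distrib]
  | tmul a b =>
    simp only [Algebra.TensorProduct.tmul_mul_tmul, one_mul, LinearMap.liftBaseChange_tmul,
      hD.leibniz j hj, smul_eq_mul, Finset.mul_sum]
    exact Finset.sum_congr rfl fun _ _ => by ring

/-- The ideal is generated by the elements 1 ⊗ r − r ⊗ 1. Multiplying by one of them cancels the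
term D₀(r) = r of the Leibniz rule and leaves only maps of smaller index, so each factor from the
ideal lowers the index by at least one. -/
theorem liftBaseChange_eq_zero (hD : IsHasseSchmidt k n D) (s : ℕ) :
    ∀ w ∈ KaehlerDifferential.ideal k R ^ s, ∀ j ≤ n, j < s →
      (D j).liftBaseChange R w = 0 := by
  induction s with
  | zero => intro _ _ j _ hj; omega
  | succ s ih =>
    intro w hw j hj hjs
    have key : ∀ u ∈ KaehlerDifferential.ideal k R, ∀ v ∈ KaehlerDifferential.ideal k R ^ s,
        (D j).liftBaseChange R (u * v) = 0 := by
      intro u hu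
      rw [← KaehlerDifferential.span_range_eq_ideal] at hu
      induction hu using Submodule.span_induction with
      | zero => intro v _; simp
      | add x y _ _ hx hy => intro v hv; rw [add_mul, map_add, hx v hv, hy v hv, add_zero]
      | smul c x _ hx =>
        intro v hv
        rw [smul_eq_mul, mul_comm c, mul_assoc]
        exact hx _ (Ideal.mul_mem_left _ _ hv)
      | mem x hx =>
        obtain ⟨r, rfl⟩ := hx
        intro v hv
        have h1 : (r ⊗ₜ[k] (1 : R)) * v = r • v := by
          rw [Algebra.smul_def]; rfl
        rw [sub_mul, map_sub, hD.liftBaseChange_mul hj, h1, map_smul, smul_eq_mul]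
        cases j with
        | zero => simp [hD.zero]
        | succ j =>
          rw [Finset.Nat.antidiagonal_succ, Finset.sum_cons, Finset.sum_map,
            Finset.sum_eq_zero]
          · simp [hD.zero]
          · intro ij hij
            have := Finset.HasAntidiagonal.mem_antidiagonal.mp hij
            rw [show (D _).liftBaseChange R v = 0 from ih v hv _ ?_ ?_, mul_zero]
            · simp; omega
            · simp; omega
    rw [pow_succ'] at hw
    exact Submodule.mul_induction_on hw key fun x y hx hy => by rw [map_add, hx, hy, add_zero]

theorem isDiffOp (hD : IsHasseSchmidt k n D) {j : ℕ} (hj : j ≤ n) : IsDiffOp k j (D j) := by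
  refine ⟨Submodule.liftQ (((KaehlerDifferential.ideal k R) ^ (j + 1)).restrictScalars R)
    ((D j).liftBaseChange R)
    fun w hw => hD.liftBaseChange_eq_zero (j + 1) w hw j hj (Nat.lt_succ_self j), fun r => ?_⟩
  refine Eq.trans ?_ (Submodule.liftQ_apply
    (((KaehlerDifferential.ideal k R) ^ (j + 1)).restrictScalars R)
    ((D j).liftBaseChange R) (h := _) ((1 : R) ⊗ₜ[k] r)).symm
  simp

/-- In a product of r factors from J, the index j is spent on at most j factors. -/
theorem mem_pow (hD : IsHasseSchmidt k n D) (J : Ideal R) (r : ℕ) :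
    ∀ f ∈ J ^ r, ∀ j ≤ n, ∀ s, s + j ≤ r → D j f ∈ J ^ s := by
  induction r with
  | zero => intro f _ j _ s hs; obtain rfl : s = 0 := by omega
            simp
  | succ r ih =>
    intro f hf j hj s hs
    rw [pow_succ'] at hf
    refine Submodule.mul_induction_on hf ?_ fun x y hx hy => by
      rw [map_add]; exact add_mem hx hy
    intro a ha b hb
    cases j with
    | zero =>
      rw [hD.zero]
      exact Ideal.pow_le_pow_right (by omega : s ≤ r + 1)
        (by rw [pow_succ']; exact Ideal.mul_mem_mul ha hb)
    | succ j =>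
      rw [hD.leibniz_succ hj]
      refine add_mem ?_ (Ideal.sum_mem _ fun ij hij => ?_)
      · cases s with
        | zero => simp
        | succ s =>
          rw [pow_succ']
          exact Ideal.mul_mem_mul ha (ih b hb _ hj s (by omega))
      · have := Finset.HasAntidiagonal.mem_antidiagonal.mp hij
        exact Ideal.mul_mem_left _ _ (ih b hb _ (by omega) s (by omega))

end IsHasseSchmidt

/-! ### Lifting tangent vectors by formal smoothness -/

/-- A Noetherian local `k`-algebra with residue field `k` in which every tangent vector at the
closed point is the first-order term of Hasse–Schmidt derivations of any length. -/
structure IsHasseSmooth (k : Type u) (R : Type v) [Field k] [CommRing R] [IsLocalRing R]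
    [Algebra k R] : Prop where
  isNoetherianRing : IsNoetherianRing R
  exists_sub_mem : ∀ f : R, ∃ c : k, f - algebraMap k R c ∈ IsLocalRing.maximalIdeal R
  exists_isHasseSchmidt : ∀ lam : R →ₗ[k] k, lam 1 = 0 →
    (∀ f ∈ IsLocalRing.maximalIdeal R ^ 2, lam f = 0) → ∀ n, ∃ D : ℕ → R →ₗ[k] R,
      IsHasseSchmidt k n D ∧ ∀ f, D 1 f - algebraMap k R (lam f) ∈ IsLocalRing.maximalIdeal R

section FormallySmooth

variable {k : Type u} {A : Type v} [Field k] [CommRing A] [Algebra k A]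

/-- Such a functional is a point derivation: after subtracting residues, the product of f and g lies
in m², which `lam` kills. -/
theorem sub_mem_of_tangentVector (m : Ideal A) (hres : ∀ f : A, ∃ c : k, f - algebraMap k A c ∈ m)
    (lam : A →ₗ[k] k) (h1 : lam 1 = 0) (h2 : ∀ f ∈ m ^ 2, lam f = 0) (f g : A) :
    algebraMap k A (lam (f * g)) -
      (f * algebraMap k A (lam g) + algebraMap k A (lam f) * g) ∈ m := by
  obtain ⟨c, hc⟩ := hres f
  obtain ⟨d, hd⟩ := hres g
  have key : f * g = (f - algebraMap k A c) * (g - algebraMap k A d) + c • g + d • f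
      - (c * d) • (1 : A) := by
    simp only [Algebra.smul_def, map_mul]; ring
  have h3 : lam ((f - algebraMap k A c) * (g - algebraMap k A d)) = 0 :=
    h2 _ (by rw [pow_two]; exact Ideal.mul_mem_mul hc hd)
  have h4 : lam (f * g) = c * lam g + d * lam f := by
    rw [key, map_sub, map_add, map_add, h3, map_smul, map_smul, map_smul, h1]
    simp
  have h5 : algebraMap k A (lam (f * g)) - (f * algebraMap k A (lam g) + algebraMap k A (lam f) * g)
      = -((f - algebraMap k A c) * algebraMap k A (lam g) +
        algebraMap k A (lam f) * (g - algebraMap k A d)) := by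
    rw [h4, map_add, map_mul, map_mul]; ring
  rw [h5]
  exact neg_mem (add_mem (Ideal.mul_mem_right _ _ hc) (Ideal.mul_mem_left _ _ hd))

theorem coeff_zero_mul_eq (F G : PowerSeries A) : PowerSeries.coeff 0 (F * G) =
    PowerSeries.coeff 0 F * PowerSeries.coeff 0 G := by
  simp

theorem coeff_one_mul_eq (F G : PowerSeries A) : PowerSeries.coeff 1 (F * G) =
    PowerSeries.coeff 0 F * PowerSeries.coeff 1 G +
      PowerSeries.coeff 1 F * PowerSeries.coeff 0 G := by
  rw [PowerSeries.coeff_mul, Finset.Nat.antidiagonal_succ]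
  simp

/-- Power series with vanishing constant coefficient and linear coefficient in `m`. -/
noncomputable def tangentIdeal (m : Ideal A) : Ideal (PowerSeries A) where
  carrier := {F | PowerSeries.coeff 0 F = 0 ∧ PowerSeries.coeff 1 F ∈ m}
  zero_mem' := by simp
  add_mem' := fun {F G} hF hG => by
    refine ⟨by rw [map_add, hF.1, hG.1, add_zero], ?_⟩
    rw [map_add]
    exact add_mem hF.2 hG.2
  smul_mem' := fun c F hF => by
    rw [smul_eq_mul, Set.mem_ofPred_eq, coeff_zero_mul_eq, coeff_one_mul_eq, hF.1, mul_zero, mul_zero,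
      add_zero]
    exact ⟨rfl, Ideal.mul_mem_left _ _ hF.2⟩

theorem mem_tangentIdeal {m : Ideal A} {F : PowerSeries A} :
    F ∈ tangentIdeal m ↔ PowerSeries.coeff 0 F = 0 ∧ PowerSeries.coeff 1 F ∈ m := Iff.rfl

/-- The map f ↦ f + λ(f)T is multiplicative only modulo T² and mT, that is, modulo `tangentIdeal m`.
This ideal is nilpotent modulo T^{n+2}, so formal smoothness lifts the map to A[[T]]/(T^{n+2}). The
coefficients of the lift are the D_j, and D₁ is prescribed modulo m. -/
theorem exists_isHasseSchmidt_of_formallySmooth [Algebra.FormallySmooth k A]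
    (m : Ideal A) (hres : ∀ f : A, ∃ c : k, f - algebraMap k A c ∈ m)
    (lam : A →ₗ[k] k) (h1 : lam 1 = 0) (h2 : ∀ f ∈ m ^ 2, lam f = 0) (n : ℕ) :
    ∃ D : ℕ → A →ₗ[k] A, IsHasseSchmidt k n D ∧ ∀ f, D 1 f - algebraMap k A (lam f) ∈ m := by
  classical
  -- The exponent n + 2 keeps the coefficient of T even when n = 0.
  let P : Ideal (PowerSeries A) := Ideal.span {(PowerSeries.X : PowerSeries A) ^ (n + 2)}
  have hmemP : ∀ F : PowerSeries A, F ∈ P ↔ ∀ j < n + 2, PowerSeries.coeff j F = 0 := by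
    intro F
    rw [Ideal.mem_span_singleton, PowerSeries.X_pow_dvd_iff]
  have hPK : P ≤ tangentIdeal m := by
    intro F hF
    rw [hmemP] at hF
    refine ⟨hF 0 (by omega), ?_⟩
    rw [hF 1 (by omega)]; exact zero_mem _
  let Iq : Ideal (PowerSeries A ⧸ P) := (tangentIdeal m).map (Ideal.Quotient.mk P)
  have hnil : IsNilpotent Iq := by
    refine ⟨n + 2, ?_⟩
    rw [← Ideal.map_pow]
    refine Ideal.map_mk_eq_bot_of_le ?_
    have : tangentIdeal m ≤ Ideal.span {(PowerSeries.X : PowerSeries A)} := by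
      intro F hF
      rw [Ideal.mem_span_singleton, PowerSeries.X_dvd_iff]
      simpa using hF.1
    calc _ ≤ _ := Ideal.pow_right_mono this (n + 2)
      _ = P := by rw [Ideal.span_singleton_pow]
  let g₀ : A →ₗ[k] PowerSeries A :=
    { toFun := fun f => PowerSeries.mk fun j =>
        if j = 0 then f else if j = 1 then algebraMap k A (lam f) else 0
      map_add' := fun f g => by
        ext j
        simp only [PowerSeries.coeff_mk, map_add]
        split_ifs <;> simp
      map_smul' := fun c f => by
        ext j
        simp only [PowerSeries.coeff_mk, RingHom.id_apply, map_smul, PowerSeries.coeff_smul]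
        split_ifs <;> simp [Algebra.smul_def] }
  have hg₀ : ∀ f, PowerSeries.coeff 0 (g₀ f) = f ∧
      PowerSeries.coeff 1 (g₀ f) = algebraMap k A (lam f) := fun f =>
    ⟨by simp [g₀], by simp [g₀]⟩
  have hmul : ∀ f g, g₀ (f * g) - g₀ f * g₀ g ∈ tangentIdeal m := by
    intro f g
    rw [mem_tangentIdeal, map_sub, map_sub, coeff_zero_mul_eq, coeff_one_mul_eq, (hg₀ _).1, (hg₀ _).1,
      (hg₀ _).1, (hg₀ _).2, (hg₀ _).2, (hg₀ _).2]
    exact ⟨sub_self _, sub_mem_of_tangentVector m hres lam h1 h2 f g⟩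
  let q : PowerSeries A →ₐ[k] (PowerSeries A ⧸ P) ⧸ Iq :=
    (Ideal.Quotient.mkₐ k Iq).comp (Ideal.Quotient.mkₐ k P)
  have hq : ∀ F G, F - G ∈ tangentIdeal m → q F = q G := by
    intro F G hFG
    refine Ideal.Quotient.eq.mpr ?_
    rw [← map_sub]
    exact Ideal.mem_map_of_mem _ hFG
  have hq' : ∀ F G, q F = q G → F - G ∈ tangentIdeal m := by
    intro F G hFG
    have h3 := Ideal.Quotient.eq.mp hFG
    rw [← map_sub] at h3
    obtain ⟨x, hx, hxe⟩ := (Ideal.mem_map_iff_of_surjective _ Ideal.Quotient.mk_surjective).mp h3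
    have h4 := hPK (Ideal.Quotient.eq.mp hxe)
    have := sub_mem hx h4
    simpa using this
  let g : A →ₐ[k] (PowerSeries A ⧸ P) ⧸ Iq := AlgHom.ofLinearMap (q.toLinearMap.comp g₀)
    (by
      change q (g₀ 1) = 1
      rw [← map_one q]
      congr 1
      ext j
      simp [g₀, h1, PowerSeries.coeff_one])
    (fun f g => by
      change q (g₀ (f * g)) = q (g₀ f) * q (g₀ g)
      rw [← map_mul]
      exact hq _ _ (hmul f g))
  let θ : A →ₐ[k] PowerSeries A ⧸ P := Algebra.FormallySmooth.lift Iq hnil g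
  -- Representatives are arbitrary, since only the coefficients below n + 2 are used and these
  -- depend on the class alone.
  choose rep hrep using fun b : PowerSeries A ⧸ P => Ideal.Quotient.mk_surjective b
  have hcoeff : ∀ F b, Ideal.Quotient.mk P F = b → ∀ j < n + 2,
      PowerSeries.coeff j (rep b) = PowerSeries.coeff j F := by
    intro F b hF j hj
    rw [← hrep b] at hF
    have := (hmemP _).mp (Ideal.Quotient.eq.mp hF) j hj
    rw [map_sub, sub_eq_zero] at this
    exact this.symm
  let D : ℕ → A →ₗ[k] A := fun j => if hj : j < n + 2 then
    { toFun := fun f => PowerSeries.coeff j (rep (θ f))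
      map_add' := fun f g => by
        rw [← map_add]
        exact hcoeff _ _ (by rw [map_add, hrep, hrep, map_add]) j hj
      map_smul' := fun c f => by
        rw [RingHom.id_apply, ← PowerSeries.coeff_smul]
        refine hcoeff _ _ ?_ j hj
        exact (map_smul (Ideal.Quotient.mkₐ k P) c _).trans
          (by rw [Ideal.Quotient.mkₐ_eq_mk, hrep, map_smul]) } else 0
  have hDval : ∀ j < n + 2, ∀ f, D j f = PowerSeries.coeff j (rep (θ f)) := by
    intro j hj f
    simp only [D, dif_pos hj]
    rfl
  have hbase : ∀ f, rep (θ f) - g₀ f ∈ tangentIdeal m := by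
    intro f
    refine hq' _ _ ?_
    change Ideal.Quotient.mk Iq (Ideal.Quotient.mk P (rep (θ f))) = g f
    rw [hrep]
    exact Algebra.FormallySmooth.mk_lift Iq hnil g f
  refine ⟨D, ⟨fun f => ?_, fun j hj f g => ?_⟩, fun f => ?_⟩
  · have := (hbase f).1
    rw [map_sub, (hg₀ f).1, sub_eq_zero] at this
    rw [hDval 0 (by omega), this]
  · rw [hDval j (by omega), hcoeff (rep (θ f) * rep (θ g)) _ (by rw [map_mul, hrep, hrep, map_mul])
      j (by omega), PowerSeries.coeff_mul]
    refine Finset.sum_congr rfl fun ij hij => ?_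
    have := Finset.HasAntidiagonal.mem_antidiagonal.mp hij
    rw [hDval _ (by omega), hDval _ (by omega)]
  · have := (hbase f).2
    rw [map_sub, (hg₀ f).2] at this
    rwa [hDval 1 (by omega)]

end FormallySmooth

theorem IsLocalRingAtClosedPoint.isHasseSmooth {k : Type u} {R : Type v} [Field k] [IsAlgClosed k]
    [CommRing R] [IsLocalRing R] [Algebra k R] (hR : IsLocalRingAtClosedPoint k R) :
    IsHasseSmooth k R := by
  obtain ⟨A, _, _, _, _, M, _, _, _, _⟩ := hR
  have : Algebra.FormallySmooth A R := Algebra.FormallySmooth.of_isLocalization M.primeCompl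
  have : Algebra.FormallySmooth k R := Algebra.FormallySmooth.comp k A R
  have : IsNoetherianRing A := Algebra.FiniteType.isNoetherianRing k A
  -- Nullstellensatz: A/M is finite over the algebraically closed field k, hence equal to k.
  have hM : ∀ a : A, ∃ c : k, a - algebraMap k A c ∈ M := by
    intro a
    let _ := Ideal.Quotient.field M
    have : Algebra.FiniteType k (A ⧸ M) :=
      Algebra.FiniteType.of_surjective (Ideal.Quotient.mkₐ k M) Ideal.Quotient.mk_surjective
    have : Module.Finite k (A ⧸ M) := finite_of_finite_type_of_isJacobsonRing k (A ⧸ M)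
    obtain ⟨c, hc⟩ := (IsAlgClosed.algebraMap_bijective_of_isIntegral (k := k) (K := A ⧸ M)).2
      (Ideal.Quotient.mk M a)
    exact ⟨c, Ideal.Quotient.eq.mp hc.symm⟩
  have hunit : ∀ a : A, a ∈ M → algebraMap A R a ∈ IsLocalRing.maximalIdeal R := fun a ha =>
    (IsLocalization.AtPrime.to_map_mem_maximal_iff R M a).mpr ha
  have hres : ∀ f : R, ∃ c : k, f - algebraMap k R c ∈ IsLocalRing.maximalIdeal R := by
    intro f
    obtain ⟨a, s, rfl⟩ := IsLocalization.exists_mk'_eq M.primeCompl f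
    obtain ⟨α, hα⟩ := hM a
    obtain ⟨σ, hσ⟩ := hM s
    have hσ0 : σ ≠ 0 := by
      rintro rfl
      exact s.2 (by simpa using hσ)
    refine ⟨α / σ, ?_⟩
    have hu : IsUnit (algebraMap A R s) := IsLocalization.map_units R s
    refine (Ideal.unit_mul_mem_iff_mem _ hu).mp ?_
    rw [mul_sub, mul_comm, IsLocalization.mk'_spec, IsScalarTower.algebraMap_apply k A R,
      ← map_mul, ← map_sub]
    refine hunit _ ?_
    have : a - s * algebraMap k A (α / σ) =
        (a - algebraMap k A α) - (s - algebraMap k A σ) * algebraMap k A (α / σ) := by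
      rw [sub_mul, ← map_mul, mul_div_cancel₀ _ hσ0]; ring
    rw [this]
    exact sub_mem hα (Ideal.mul_mem_right _ _ hσ)
  exact ⟨IsLocalization.isNoetherianRing M.primeCompl R inferInstance, hres,
    fun lam h1 h2 n => exists_isHasseSchmidt_of_formallySmooth _ hres lam h1 h2 n⟩

/-! ### Passage to the completion -/

open IsLocalRing

/-- `ι` exhibits the local `k`-algebra `R` as the completion of `R₀`. -/
structure IsCompletionMap {k : Type u} {R₀ R : Type v} [Field k] [CommRing R₀] [IsLocalRing R₀]
    [Algebra k R₀] [CommRing R] [IsLocalRing R] [Algebra k R] (ι : R₀ →ₐ[k] R) : Prop where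
  isAdicComplete : IsAdicComplete (maximalIdeal R) R
  exists_sub_mem : ∀ n f, ∃ g, f - ι g ∈ maximalIdeal R ^ n
  map_maximalIdeal : (maximalIdeal R₀).map ι = maximalIdeal R
  map_mem_iff : ∀ n g, ι g ∈ maximalIdeal R ^ n ↔ g ∈ maximalIdeal R₀ ^ n

section

variable {k : Type u} {R₀ R : Type v} [Field k] [CommRing R₀] [IsLocalRing R₀]
    [Algebra k R₀] [CommRing R] [IsLocalRing R] [Algebra k R]

theorem exists_isCompletionMap [IsNoetherianRing R₀]
    (e : R ≃ₐ[k] AdicCompletion (maximalIdeal R₀) R₀) :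
    ∃ ι : R₀ →ₐ[k] R, IsCompletionMap ι := by
  have hfg : (maximalIdeal R₀).FG := IsNoetherian.noetherian _
  let ofk : R₀ →ₐ[k] AdicCompletion (maximalIdeal R₀) R₀ :=
    { algebraMap R₀ (AdicCompletion (maximalIdeal R₀) R₀) with
      commutes' := fun c => rfl }
  have hof : ∀ g, ofk g = AdicCompletion.of (maximalIdeal R₀) R₀ g := fun g => rfl
  -- Because the maximal ideal of R₀ is finitely generated, the powers of its extension are the
  -- kernels of the evaluation maps.
  have hpow : ∀ n (f : AdicCompletion (maximalIdeal R₀) R₀),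
      f ∈ maximalIdeal (AdicCompletion (maximalIdeal R₀) R₀) ^ n ↔
        AdicCompletion.eval (maximalIdeal R₀) R₀ n f = 0 := by
    intro n f
    rw [AdicCompletion.maximalIdeal_eq_map, ← Ideal.map_pow, ← LinearMap.mem_ker,
      ← AdicCompletion.pow_smul_top_eq_ker_eval hfg, Ideal.smul_top_eq_map]
    rfl
  have hmap : (maximalIdeal R).map e.toRingEquiv =
      maximalIdeal (AdicCompletion (maximalIdeal R₀) R₀) := by
    exact IsLocalRing.eq_maximalIdeal (Ideal.map_isMaximal_of_equiv e.toRingEquiv)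
  have hmem : ∀ n f, f ∈ maximalIdeal R ^ n ↔
      e f ∈ maximalIdeal (AdicCompletion (maximalIdeal R₀) R₀) ^ n := by
    intro n f
    rw [← hmap, ← Ideal.map_pow]
    exact (Ideal.apply_mem_of_equiv_iff (f := e.toRingEquiv)).symm
  have hmi : ∀ n g, (e.symm.toAlgHom.comp ofk) g ∈ maximalIdeal R ^ n ↔
      g ∈ maximalIdeal R₀ ^ n := by
    intro n g
    rw [hmem, hpow]
    change AdicCompletion.eval _ _ _ (e (e.symm (ofk g))) = 0 ↔ _
    rw [e.apply_symm_apply, hof, AdicCompletion.eval_of, Submodule.mkQ_apply,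
      Submodule.Quotient.mk_eq_zero]
    simp
  refine ⟨e.symm.toAlgHom.comp ofk, ?_, fun n f => ?_, ?_, hmi⟩
  · rw [← IsAdicComplete.congr_ringEquiv _ e.toRingEquiv, hmap]
    infer_instance
  · obtain ⟨g, hg⟩ := Submodule.Quotient.mk_surjective _
      (AdicCompletion.eval (maximalIdeal R₀) R₀ n (e f))
    refine ⟨g, ?_⟩
    rw [hmem, hpow, map_sub, map_sub, sub_eq_zero, ← hg]
    change _ = AdicCompletion.eval _ _ _ (e (e.symm (ofk g)))
    rw [e.apply_symm_apply, hof, AdicCompletion.eval_of]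
    rfl
  · refine le_antisymm (Ideal.map_le_iff_le_comap.mpr fun g hg => ?_) fun f hf => ?_
    · rw [Ideal.mem_comap, ← pow_one (maximalIdeal R), hmi, pow_one]
      exact hg
    · rw [← pow_one (maximalIdeal R), hmem, pow_one, AdicCompletion.maximalIdeal_eq_map] at hf
      have h1 : (maximalIdeal R₀).map (algebraMap R₀ (AdicCompletion (maximalIdeal R₀) R₀)) ≤
          ((maximalIdeal R₀).map (e.symm.toAlgHom.comp ofk)).comap e.symm :=
        Ideal.map_le_iff_le_comap.mpr fun g hg =>
          Ideal.mem_map_of_mem (e.symm.toAlgHom.comp ofk) hg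
      have h2 := h1 hf
      rwa [Ideal.mem_comap, e.symm_apply_apply] at h2

variable {ι : R₀ →ₐ[k] R}

namespace IsCompletionMap

theorem eq_zero (hι : IsCompletionMap ι) {f : R} (hf : ∀ n, f ∈ maximalIdeal R ^ n) : f = 0 := by
  have := hι.isAdicComplete
  refine IsHausdorff.haus (I := maximalIdeal R) inferInstance f fun n => ?_
  rw [SModEq.zero]
  simpa using hf n

/-- `L` is the value at `f` of the extension by continuity of `d`, an additive map lowering orders
by at most `j`. -/
def IsExtensionAt (ι : R₀ →ₐ[k] R) (d : R₀ → R₀) (j : ℕ) (f L : R) : Prop :=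
  ∀ n g, f - ι g ∈ maximalIdeal R ^ (n + j) → L - ι (d g) ∈ maximalIdeal R ^ n

theorem IsExtensionAt.unique (hι : IsCompletionMap ι) {d : R₀ → R₀} {j : ℕ} {f L L' : R}
    (h : IsExtensionAt ι d j f L) (h' : IsExtensionAt ι d j f L') : L = L' := by
  refine sub_eq_zero.mp (hι.eq_zero fun n => ?_)
  obtain ⟨g, hg⟩ := hι.exists_sub_mem (n + j) f
  have := sub_mem (h n g hg) (h' n g hg)
  simpa using this

/-- One good approximation in each order is enough: two of them differ by an element which d sends
into 𝔪^n. -/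
theorem IsExtensionAt.of_forall_exists {d : R₀ →ₗ[k] R₀} {j : ℕ} {f L : R}
    (hι : IsCompletionMap ι)
    (hd : ∀ n, ∀ f ∈ maximalIdeal R₀ ^ (n + j), d f ∈ maximalIdeal R₀ ^ n)
    (h : ∀ n, ∃ g, f - ι g ∈ maximalIdeal R ^ (n + j) ∧ L - ι (d g) ∈ maximalIdeal R ^ n) :
    IsExtensionAt ι d j f L := by
  intro n g hg
  obtain ⟨g', hg', hL⟩ := h n
  have h1 : ι (g' - g) ∈ maximalIdeal R ^ (n + j) := by
    have := sub_mem hg hg'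
    rw [map_sub]
    convert this using 1; ring
  have h2 := (hι.map_mem_iff n _).mpr (hd n _ ((hι.map_mem_iff _ _).mp h1))
  have := add_mem hL h2
  rw [map_sub, map_sub] at this
  convert this using 1; ring

theorem exists_isExtensionAt (hι : IsCompletionMap ι) {d : R₀ →ₗ[k] R₀} {j : ℕ}
    (hd : ∀ n, ∀ f ∈ maximalIdeal R₀ ^ (n + j), d f ∈ maximalIdeal R₀ ^ n) (f : R) :
    ∃ L, IsExtensionAt ι d j f L := by
  have := hι.isAdicComplete
  choose g hg using fun n => hι.exists_sub_mem (n + j) f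
  have hcauchy : ∀ {m n}, m ≤ n → ι (d (g m)) ≡ ι (d (g n))
      [SMOD (maximalIdeal R ^ m • ⊤ : Submodule R R)] := by
    intro m n hmn
    rw [SModEq.sub_mem, ← map_sub, ← map_sub]
    rw [smul_eq_mul, Ideal.mul_top, hι.map_mem_iff]
    refine hd _ _ ((hι.map_mem_iff _ _).mp ?_)
    have := sub_mem (Ideal.pow_le_pow_right (show m + j ≤ n + j by omega) (hg n)) (hg m)
    rw [map_sub]
    convert this using 1; ring
  obtain ⟨L, hL⟩ := IsPrecomplete.prec (I := maximalIdeal R) inferInstance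
    (f := fun n => ι (d (g n))) hcauchy
  refine ⟨L, .of_forall_exists hι hd fun n => ⟨g n, hg n, ?_⟩⟩
  have h := (hL n).symm
  rw [SModEq.sub_mem, smul_eq_mul, Ideal.mul_top] at h
  exact h

/-- Each D_j lowers orders by at most j, so it extends by continuity. Linearity and the Leibniz rule
hold on approximations and follow from uniqueness of the extension. -/
theorem exists_isHasseSchmidt (hι : IsCompletionMap ι) {n : ℕ} {D₀ : ℕ → R₀ →ₗ[k] R₀}
    (hD₀ : IsHasseSchmidt k n D₀) : ∃ D : ℕ → R →ₗ[k] R, IsHasseSchmidt k n D ∧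
      ∀ j ≤ n, ∀ f, IsExtensionAt ι (D₀ j) j f (D j f) := by
  classical
  have hd : ∀ j ≤ n, ∀ s, ∀ f ∈ maximalIdeal R₀ ^ (s + j), D₀ j f ∈ maximalIdeal R₀ ^ s :=
    fun j hj s f hf => hD₀.mem_pow _ _ f hf j hj s le_rfl
  choose E hE using fun (j : {j // j ≤ n}) f => hι.exists_isExtensionAt (hd j.1 j.2) f
  let D : ℕ → R →ₗ[k] R := fun j => if hj : j ≤ n then
    { toFun := fun f => E ⟨j, hj⟩ f
      map_add' := fun f g => by
        refine IsExtensionAt.unique hι (hE ⟨j, hj⟩ (f + g))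
          (.of_forall_exists hι (hd j hj) fun s => ?_)
        obtain ⟨f', hf'⟩ := hι.exists_sub_mem (s + j) f
        obtain ⟨g', hg'⟩ := hι.exists_sub_mem (s + j) g
        refine ⟨f' + g', ?_, ?_⟩
        · have := add_mem hf' hg'
          rw [map_add]; convert this using 1; ring
        · have := add_mem (hE ⟨j, hj⟩ f s f' hf') (hE ⟨j, hj⟩ g s g' hg')
          rw [map_add, map_add]; convert this using 1; ring
      map_smul' := fun c f => by
        refine IsExtensionAt.unique hι (hE ⟨j, hj⟩ (c • f))
          (.of_forall_exists hι (hd j hj) fun s => ?_)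
        obtain ⟨f', hf'⟩ := hι.exists_sub_mem (s + j) f
        refine ⟨c • f', ?_, ?_⟩
        · rw [map_smul, ← smul_sub]
          exact Submodule.smul_of_tower_mem _ c hf'
        · rw [map_smul, map_smul, RingHom.id_apply, ← smul_sub]
          exact Submodule.smul_of_tower_mem _ c (hE ⟨j, hj⟩ f s f' hf') } else 0
  have hD : ∀ j ≤ n, ∀ f, IsExtensionAt ι (D₀ j) j f (D j f) := by
    intro j hj f
    simp only [D, dif_pos hj]
    exact hE ⟨j, hj⟩ f
  refine ⟨D, ⟨fun f => ?_, fun j hj f g => ?_⟩, hD⟩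
  · refine (hD 0 (Nat.zero_le _) f).unique hι fun s g hg => ?_
    rw [hD₀.zero]; exact hg
  · refine (hD j hj (f * g)).unique hι (.of_forall_exists hι (hd j hj) fun s => ?_)
    obtain ⟨f', hf'⟩ := hι.exists_sub_mem (s + j) f
    obtain ⟨g', hg'⟩ := hι.exists_sub_mem (s + j) g
    refine ⟨f' * g', ?_, ?_⟩
    · rw [map_mul, show f * g - ι f' * ι g' = (f - ι f') * g + ι f' * (g - ι g') by ring]
      exact add_mem (Ideal.mul_mem_right _ _ hf') (Ideal.mul_mem_left _ _ hg')
    · rw [hD₀.leibniz j hj, map_sum, ← Finset.sum_sub_distrib]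
      refine Ideal.sum_mem _ fun ij hij => ?_
      have h := Finset.HasAntidiagonal.mem_antidiagonal.mp hij
      have h1 := hD ij.1 (by omega) f s f'
        (Ideal.pow_le_pow_right (show s + ij.1 ≤ s + j by omega) hf')
      have h2 := hD ij.2 (by omega) g s g'
        (Ideal.pow_le_pow_right (show s + ij.2 ≤ s + j by omega) hg')
      rw [map_mul]
      have : ∀ a b a' b' : R, a * b - a' * b' = (a - a') * b + a' * (b - b') := by
        intros; ring
      rw [this]
      exact add_mem (Ideal.mul_mem_right _ _ h1) (Ideal.mul_mem_left _ _ h2)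

theorem algebraMap_residue (hι : IsCompletionMap ι)
    (hres : ∀ f : R₀, ∃ c : k, f - algebraMap k R₀ c ∈ maximalIdeal R₀) (f : R) :
    ∃ c : k, f - algebraMap k R c ∈ maximalIdeal R := by
  obtain ⟨g, hg⟩ := hι.exists_sub_mem 1 f
  obtain ⟨c, hc⟩ := hres g
  refine ⟨c, ?_⟩
  have h1 := (hι.map_mem_iff 1 _).mpr (by rwa [pow_one] : g - algebraMap k R₀ c ∈ _ ^ 1)
  have := add_mem hg h1
  rw [map_sub, AlgHom.commutes, pow_one] at this
  convert this using 1; ring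

end IsCompletionMap

end

/-- Generators of the maximal ideal define a map from a power series ring over k to R. It is
surjective modulo the variables because the residue field is k, hence surjective by successive
approximation. -/
theorem isNoetherianRing_of_isAdicComplete {k : Type u} {R : Type v} [Field k] [CommRing R]
    [IsLocalRing R] [Algebra k R] [hc : IsAdicComplete (maximalIdeal R) R]
    (hres : ∀ f : R, ∃ c : k, f - algebraMap k R c ∈ maximalIdeal R)
    (hfg : (maximalIdeal R).FG) : IsNoetherianRing R := by
  obtain ⟨s, hs⟩ := hfg
  let x : s → R := fun i => i.1
  have hx : Ideal.span (Set.range x) = maximalIdeal R := by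
    rw [← hs]; congr 1; exact Subtype.range_coe
  have hle : ∀ n, ∀ p ∈ MvPolynomial.idealOfVars s k ^ n,
      MvPolynomial.aeval x p ∈ maximalIdeal R ^ n := by
    intro n p hp
    have h1 : (MvPolynomial.idealOfVars s k).map (MvPolynomial.aeval x : _ →ₐ[k] R) ≤
        maximalIdeal R := by
      rw [MvPolynomial.idealOfVars, Ideal.map_span, ← hx]
      refine Ideal.span_mono ?_
      rintro _ ⟨_, ⟨i, rfl⟩, rfl⟩
      exact ⟨i, (MvPolynomial.aeval_X x i).symm⟩
    have h2 := Ideal.mem_map_of_mem (MvPolynomial.aeval x : _ →ₐ[k] R) hp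
    rw [Ideal.map_pow] at h2
    exact Ideal.pow_right_mono h1 n h2
  let φ : ∀ n, MvPolynomial s k ⧸ MvPolynomial.idealOfVars s k ^ n →+* R ⧸ maximalIdeal R ^ n :=
    fun n => Ideal.quotientMap _ (MvPolynomial.aeval x : _ →ₐ[k] R).toRingHom (hle n)
  let F : ∀ n, MvPowerSeries s k →+* R ⧸ maximalIdeal R ^ n := fun n =>
    (φ n).comp (MvPowerSeries.truncTotalAlgHom s k n).toRingHom
  have hF : ∀ n p, F n p = Ideal.Quotient.mk _ (MvPolynomial.aeval x (p.truncTotal n)) :=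
    fun n p => rfl
  have hcompat : ∀ {m n : ℕ} (hle : m ≤ n), (Ideal.Quotient.factorPow _ hle).comp (F n) = F m := by
    intro m n hmn
    ext p
    rw [RingHom.comp_apply, hF, hF]
    refine Ideal.Quotient.eq.mpr ?_
    rw [← map_sub]
    exact hle _ _ (MvPowerSeries.truncTotal_sub_truncTotal_mem_pow_idealOfVars hmn le_rfl p)
  let f : MvPowerSeries s k →+* R := IsAdicComplete.liftRingHom (maximalIdeal R) F hcompat
  have hf : ∀ p : MvPolynomial s k, f (algebraMap _ (MvPowerSeries s k) p) =
      MvPolynomial.aeval x p := by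
    intro p
    refine (IsHausdorff.eq_iff_smodEq (I := maximalIdeal R)).mpr fun n => ?_
    rw [SModEq.sub_mem, smul_eq_mul, Ideal.mul_top]
    refine Ideal.Quotient.eq.mp ?_
    rw [IsAdicComplete.mk_liftRingHom]
    change φ n (MvPowerSeries.truncTotalAlgHom s k n _) = _
    rw [AlgHom.commutes]
    rfl
  have hmap : (Ideal.span (Set.range MvPowerSeries.X)).map f = maximalIdeal R := by
    rw [Ideal.map_span, ← Set.range_comp, ← hx]
    congr 2
    ext i
    have := hf (MvPolynomial.X i)
    rw [MvPolynomial.aeval_X] at this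
    rw [← this, Function.comp_apply]
    congr 1
    simp [MvPowerSeries.algebraMap_apply']
  have : IsHausdorff ((Ideal.span (Set.range MvPowerSeries.X)).map f) R := by
    rw [hmap]; infer_instance
  refine isNoetherianRing_of_surjective _ _ f (surjective_of_mk_map_comp_surjective
    (I := Ideal.span (Set.range MvPowerSeries.X)) f fun y => ?_)
  obtain ⟨g, rfl⟩ := Ideal.Quotient.mk_surjective y
  obtain ⟨c, hc⟩ := hres g
  refine ⟨algebraMap (MvPolynomial s k) _ (MvPolynomial.C c), ?_⟩
  rw [RingHom.comp_apply, hf, eq_comm, Ideal.Quotient.eq, hmap, MvPolynomial.aeval_C]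
  exact hc

theorem IsCompletionMap.isHasseSmooth {k : Type u} {R₀ R : Type v} [Field k] [CommRing R₀]
    [IsLocalRing R₀] [Algebra k R₀] [CommRing R] [IsLocalRing R] [Algebra k R] {ι : R₀ →ₐ[k] R}
    (hι : IsCompletionMap ι) (h : IsHasseSmooth k R₀) : IsHasseSmooth k R := by
  have := hι.isAdicComplete
  have := h.isNoetherianRing
  have hres := hι.algebraMap_residue h.exists_sub_mem
  refine ⟨isNoetherianRing_of_isAdicComplete hres ?_, hres, fun lam h1 h2 n => ?_⟩
  · rw [← hι.map_maximalIdeal]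
    exact Ideal.FG.map (IsNoetherian.noetherian (maximalIdeal R₀)) _
  -- Length n + 1 ensures that index 1 is covered when n = 0.
  · obtain ⟨D₀, hD₀, hlam⟩ := h.exists_isHasseSchmidt (lam ∘ₗ ι.toLinearMap) (by simpa using h1)
      (fun f hf => h2 _ ((hι.map_mem_iff 2 f).mpr hf)) (n + 1)
    obtain ⟨D, hD, hext⟩ := hι.exists_isHasseSchmidt hD₀
    refine ⟨D, ⟨hD.zero, fun j hj => hD.leibniz j (by omega)⟩, fun f => ?_⟩
    obtain ⟨g, hg⟩ := hι.exists_sub_mem 2 f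
    have h3 := hext 1 (by omega) f 1 g hg
    have h4 := (hι.map_mem_iff 1 _).mpr (by rw [pow_one]; exact hlam g)
    have h5 : lam f = lam (ι g) := by
      have := h2 _ hg
      rwa [map_sub, sub_eq_zero] at this
    have := add_mem h3 h4
    rw [map_sub, AlgHom.commutes, pow_one] at this
    rw [h5]
    simpa using this

theorem IsCompletedLocalRingAtClosedPoint.isHasseSmooth {k : Type u} {R : Type v} [Field k]
    [IsAlgClosed k] [CommRing R] [IsLocalRing R] [Algebra k R]
    (hR : IsCompletedLocalRingAtClosedPoint k R) : IsHasseSmooth k R := by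
  obtain ⟨R₀, _, _, _, hR₀, ⟨e⟩⟩ := hR
  have h := hR₀.isHasseSmooth
  have := h.isNoetherianRing
  obtain ⟨ι, hι⟩ := exists_isCompletionMap e
  exact hι.isHasseSmooth h

/-! ### Coordinates and divided-power operators on monomials -/

section Monomial

variable {R : Type v} [CommRing R] {σ : Type} [Fintype σ]

/-- The monomial `∏ x i ^ J i`. -/
def mono (x : σ → R) (J : σ → ℕ) : R := ∏ i, x i ^ J i

theorem mono_zero (x : σ → R) : mono x 0 = 1 := by simp [mono]

theorem mono_add (x : σ → R) (J K : σ → ℕ) : mono x (J + K) = mono x J * mono x K := by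
  simp [mono, pow_add, Finset.prod_mul_distrib]

theorem mono_single [DecidableEq σ] (x : σ → R) (i : σ) (t : ℕ) :
    mono x (Pi.single i t) = x i ^ t := by
  rw [mono, Finset.prod_eq_single i]
  · simp
  · intro j _ hj; simp [Pi.single_eq_of_ne hj]
  · simp

theorem mono_mem_pow {x : σ → R} {m : Ideal R} (hx : ∀ i, x i ∈ m) (J : σ → ℕ) :
    mono x J ∈ m ^ ∑ i, J i := by
  rw [mono, ← Finset.prod_pow_eq_pow_sum]
  exact Ideal.prod_mem_prod fun i _ => Ideal.pow_mem_pow (hx i) _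

theorem exponent_induction [DecidableEq σ] {P : (σ → ℕ) → Prop} (h0 : P 0)
    (hs : ∀ J i, P J → P (Pi.single i 1 + J)) (J : σ → ℕ) : P J := by
  induction hn : ∑ i, J i generalizing J with
  | zero =>
    have : J = 0 := by
      ext i
      exact Finset.sum_eq_zero_iff.mp hn i (Finset.mem_univ i)
    rwa [this]
  | succ n ih =>
    obtain ⟨i, hi⟩ : ∃ i, J i ≠ 0 := by
      by_contra! h
      simp [h] at hn
    have hJ : Pi.single i 1 + (J - Pi.single i 1) = J := by
      ext j
      rcases eq_or_ne j i with rfl | hj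
      · simp; omega
      · simp [Pi.single_eq_of_ne hj]
    rw [← hJ]
    refine hs _ _ (ih _ ?_)
    rw [← hJ] at hn
    simp only [Pi.add_apply, Finset.sum_add_distrib, Finset.sum_pi_single', Finset.mem_univ,
      if_true] at hn
    omega

end Monomial

/-- Elements of the maximal ideal whose classes form a `k`-basis of the cotangent space. -/
structure IsCoordinates (k : Type u) {R : Type v} [Field k] [CommRing R] [IsLocalRing R]
    [Algebra k R] {σ : Type} [Fintype σ] [DecidableEq σ] (x : σ → R) : Prop where
  mem : ∀ i, x i ∈ maximalIdeal R
  exists_sub_mem : ∀ f ∈ maximalIdeal R, ∃ c : σ → k, f - ∑ i, c i • x i ∈ maximalIdeal R ^ 2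
  exists_dual : ∀ i, ∃ lam : R →ₗ[k] k, lam 1 = 0 ∧ (∀ f ∈ maximalIdeal R ^ 2, lam f = 0) ∧
    ∀ j, lam (x j) = if j = i then 1 else 0

section

variable {k : Type u} {R : Type v} [Field k] [CommRing R] [IsLocalRing R] [Algebra k R]
  {σ : Type} [Fintype σ] [DecidableEq σ] {x : σ → R}

/-- On leading forms D_t is the divided-power derivative in direction i. The induction is Pascal's
rule: in the Leibniz expansion for x_j · g only x_j D_{t+1}(g) and D₁(x_j) D_t(g) reach the leading
form, the other terms having higher order. Truncated subtraction is harmless, as the binomial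
vanishes for t > J i. -/
theorem IsHasseSchmidt.apply_mono {n : ℕ} {D : ℕ → R →ₗ[k] R} (hD : IsHasseSchmidt k n D)
    (hx : ∀ j, x j ∈ maximalIdeal R) (i : σ)
    (h1 : ∀ j, D 1 (x j) - (if j = i then 1 else 0) ∈ maximalIdeal R) (J : σ → ℕ) :
    ∀ t ≤ n, ∀ s, s + t ≤ ∑ j, J j + 1 →
      D t (mono x J) - ((J i).choose t : R) * mono x (J - Pi.single i t) ∈
        maximalIdeal R ^ s := by
  have hmul : ∀ {a b : R} {s : ℕ}, a ∈ maximalIdeal R →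
      (s ≠ 0 → b ∈ maximalIdeal R ^ (s - 1)) →
      a * b ∈ maximalIdeal R ^ s := by
    intro a b s ha hb
    cases s with
    | zero => simp
    | succ s => rw [pow_succ']; exact Ideal.mul_mem_mul ha (hb s.succ_ne_zero)
  induction J using exponent_induction with
  | h0 =>
    intro t _ s hs
    simp only [Pi.zero_apply, Finset.sum_const_zero] at hs
    have h0 : (0 : σ → ℕ) - Pi.single i t = 0 := by ext; simp
    rw [h0]
    cases t with
    | zero => simp [hD.zero]
    | succ t =>
      obtain rfl : s = 0 := by omega
      simp
  | hs J j ih =>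
    intro t ht s hs
    simp only [Pi.add_apply, Finset.sum_add_distrib, Finset.sum_pi_single', Finset.mem_univ,
      if_true] at hs
    cases t with
    | zero => simp [hD.zero]
    | succ t =>
      set g := mono x J with hg
      have hgm : g ∈ maximalIdeal R ^ ∑ j, J j := mono_mem_pow hx J
      rw [mono_add, mono_single, pow_one, hD.leibniz_succ ht,
        ← Finset.add_sum_erase _ _ (show (0, t) ∈ Finset.HasAntidiagonal.antidiagonal t by simp)]
      set T := ∑ ij ∈ (Finset.HasAntidiagonal.antidiagonal t).erase (0, t),
        D (ij.1 + 1) (x j) * D ij.2 g with hT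
      have hTm : T ∈ maximalIdeal R ^ s := by
        refine Ideal.sum_mem _ fun ij hij => Ideal.mul_mem_left _ _ ?_
        obtain ⟨hne, hij⟩ := Finset.mem_erase.mp hij
        have h2 := Finset.HasAntidiagonal.mem_antidiagonal.mp hij
        have h3 : ij.1 ≠ 0 := fun h => hne (Prod.ext h (by simp; omega))
        exact hD.mem_pow _ _ g hgm _ (by omega) s (by omega)
      have hA : x j * (D (t + 1) g - ((J i).choose (t + 1) : R) *
          mono x (J - Pi.single i (t + 1))) ∈ maximalIdeal R ^ s :=
        hmul (hx j) fun hs0 => ih (t + 1) ht (s - 1) (by omega)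
      have hB : (D 1 (x j) - (if j = i then 1 else 0)) * D t g ∈ maximalIdeal R ^ s :=
        hmul (h1 j) fun hs0 => hD.mem_pow _ _ g hgm t (by omega) (s - 1) (by omega)
      have hC : (if j = i then (1 : R) else 0) * (D t g - ((J i).choose t : R) *
          mono x (J - Pi.single i t)) ∈ maximalIdeal R ^ s :=
        Ideal.mul_mem_left _ _ (ih t (by omega) s (by omega))
      have hmain : (((Pi.single j 1 + J : σ → ℕ) i).choose (t + 1) : R) *
          mono x (Pi.single j 1 + J - Pi.single i (t + 1)) =
          x j * (((J i).choose (t + 1) : R) * mono x (J - Pi.single i (t + 1))) +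
          (if j = i then (1 : R) else 0) * (((J i).choose t : R) *
            mono x (J - Pi.single i t)) := by
        rcases eq_or_ne j i with rfl | hj
        · have e1 : Pi.single j 1 + J - Pi.single j (t + 1) = J - Pi.single j t := by
            ext l
            rcases eq_or_ne l j with rfl | hl
            · simp; omega
            · simp [Pi.single_eq_of_ne hl]
          rw [e1, if_pos rfl, one_mul, Pi.add_apply, Pi.single_eq_same, add_comm 1,
            Nat.choose_succ_succ, Nat.cast_add, add_mul, add_comm]
          congr 1
          rcases lt_or_ge (J j) (t + 1) with hlt | hge
          · rw [Nat.choose_eq_zero_of_lt hlt]; simp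
          · have e2 : J - Pi.single j t = Pi.single j 1 + (J - Pi.single j (t + 1)) := by
              ext l
              rcases eq_or_ne l j with rfl | hl
              · simp; omega
              · simp [Pi.single_eq_of_ne hl]
            rw [e2, mono_add, mono_single, pow_one]; ring
        · have e1 : Pi.single j 1 + J - Pi.single i (t + 1) =
              Pi.single j 1 + (J - Pi.single i (t + 1)) := by
            ext l
            rcases eq_or_ne l i with rfl | hl
            · simp [Pi.single_eq_of_ne hj.symm]
            · simp [Pi.single_eq_of_ne hl]
          rw [e1, if_neg hj, zero_mul, add_zero, mono_add, mono_single, pow_one, Pi.add_apply,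
            Pi.single_eq_of_ne hj.symm, zero_add]
          ring
      have := add_mem (add_mem (add_mem hA hB) hC) hTm
      rw [hmain]
      simp only [zero_add]
      convert this using 1
      ring

/-- Compose over the coordinates the Hasse–Schmidt maps lifting the dual tangent vectors. Saturation
is applied once per factor, so no composition law for differential operators is needed. -/
theorem IsHasseSmooth.exists_operator (hS : IsHasseSmooth k R) (hx : IsCoordinates k x)
    (t : σ → ℕ) : ∃ D : R →ₗ[k] R,
      (∀ I : IdealisticFiltration R, I.IsDSaturated k → ∀ a, ∀ f ∈ I.level a,
        D f ∈ I.level (a - (∑ i, t i : ℕ))) ∧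
      (∀ r s, ∀ f ∈ maximalIdeal R ^ r, s + ∑ i, t i ≤ r → D f ∈ maximalIdeal R ^ s) ∧
      ∀ J s, s + ∑ i, t i ≤ ∑ i, J i + 1 →
        D (mono x J) - ((∏ i, (J i).choose (t i) : ℕ) : R) * mono x (J - t) ∈
          maximalIdeal R ^ s := by
  suffices H : ∀ (S : Finset σ) (t : σ → ℕ), (∀ i ∉ S, t i = 0) → ∃ D : R →ₗ[k] R,
      (∀ I : IdealisticFiltration R, I.IsDSaturated k → ∀ a, ∀ f ∈ I.level a,
        D f ∈ I.level (a - (∑ i, t i : ℕ))) ∧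
      (∀ r s, ∀ f ∈ maximalIdeal R ^ r, s + ∑ i, t i ≤ r → D f ∈ maximalIdeal R ^ s) ∧
      ∀ J s, s + ∑ i, t i ≤ ∑ i, J i + 1 →
        D (mono x J) - ((∏ i, (J i).choose (t i) : ℕ) : R) * mono x (J - t) ∈
          maximalIdeal R ^ s from
    H Finset.univ t fun i hi => absurd (Finset.mem_univ i) hi
  intro S
  induction S using Finset.induction_on with
  | empty =>
    intro t ht
    obtain rfl : t = 0 := funext fun i => ht i (by simp)
    refine ⟨LinearMap.id, fun I _ a f hf => by simpa using hf, fun r s f hf hs => ?_,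
      fun J s _ => by simp⟩
    simp only [Pi.zero_apply, Finset.sum_const_zero, add_zero] at hs
    exact Ideal.pow_le_pow_right hs hf
  | insert i S hi ih =>
    intro t ht
    set t' := Function.update t i 0 with ht'
    obtain ⟨D', h1, h2, h3⟩ := ih t' fun j hj => by
      rcases eq_or_ne j i with rfl | hji
      · simp [ht']
      · rw [ht', Function.update_of_ne hji]
        exact ht j (by simp [hji, hj])
    have ht'i : t' i = 0 := by simp [ht']
    have ht'j : ∀ j, j ≠ i → t' j = t j := fun j hj => by rw [ht', Function.update_of_ne hj]
    have hsum : ∑ j, t j = ∑ j, t' j + t i := by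
      rw [← Finset.add_sum_erase _ _ (Finset.mem_univ i),
        ← Finset.add_sum_erase _ t' (Finset.mem_univ i), ht'i, zero_add, add_comm]
      congr 1
      exact Finset.sum_congr rfl fun j hj => (ht'j j (Finset.ne_of_mem_erase hj)).symm
    have hsub : ∀ J : σ → ℕ, J - t = J - t' - Pi.single i (t i) := by
      intro J
      ext j
      rcases eq_or_ne j i with rfl | hji
      · simp [ht'i]
      · simp [ht'j j hji, Pi.single_eq_of_ne hji]
    have hprod : ∀ J : σ → ℕ, ∏ j, (J j).choose (t j) =
        (∏ j, (J j).choose (t' j)) * (J i).choose (t i) := by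
      intro J
      rw [← Finset.mul_prod_erase _ _ (Finset.mem_univ i),
        ← Finset.mul_prod_erase _ (fun j => (J j).choose (t' j)) (Finset.mem_univ i), ht'i,
        Nat.choose_zero_right, one_mul, mul_comm]
      congr 1
      exact Finset.prod_congr rfl fun j hj => by rw [ht'j j (Finset.ne_of_mem_erase hj)]
    obtain ⟨lam, hl1, hl2, hl⟩ := hx.exists_dual i
    obtain ⟨D, hD, hDlam⟩ := hS.exists_isHasseSchmidt lam hl1 hl2 (t i)
    have hD1 : ∀ j, D 1 (x j) - (if j = i then 1 else 0) ∈ maximalIdeal R := by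
      intro j
      have := hDlam (x j)
      rw [hl j] at this
      split_ifs with h
      · simpa [h] using this
      · simpa [h] using this
    refine ⟨D (t i) ∘ₗ D', fun I hI a f hf => ?_, fun r s f hf hs => ?_, fun J s hs => ?_⟩
    · have := hI _ _ _ _ (h1 I hI a f hf) (hD.isDiffOp le_rfl)
      rw [hsum, Nat.cast_add, ← sub_sub]
      exact this
    · exact hD.mem_pow _ _ _ (h2 r (s + t i) f hf (by omega)) _ le_rfl s le_rfl
    · have h4 := hD.mem_pow _ _ _ (h3 J (s + t i) (by omega)) _ le_rfl s le_rfl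
      rw [LinearMap.comp_apply, hprod, hsub]
      rw [← nsmul_eq_mul, map_sub, map_nsmul, nsmul_eq_mul] at h4
      -- If the inequality fails, a binomial factor is zero; if it holds, J − t' is a genuine
      -- difference and degrees add up.
      by_cases hle : t' ≤ J
      · have h5 : ∑ j, (J - t') j + ∑ j, t' j = ∑ j, J j := by
          rw [← Finset.sum_add_distrib]
          exact Finset.sum_congr rfl fun j _ => Nat.sub_add_cancel (hle j)
        have h6 := Ideal.mul_mem_left _ ((∏ j, (J j).choose (t' j) : ℕ) : R)
          (hD.apply_mono hx.mem i hD1 (J - t') (t i) le_rfl s (by omega))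
        rw [Pi.sub_apply, ht'i, Nat.sub_zero] at h6
        have := add_mem h4 h6
        convert this using 1
        push_cast
        ring
      · obtain ⟨j, hj⟩ : ∃ j, J j < t' j := by simpa [Pi.le_def] using hle
        have h0 : ∏ j, (J j).choose (t' j) = 0 :=
          Finset.prod_eq_zero (Finset.mem_univ j) (Nat.choose_eq_zero_of_lt hj)
        rw [h0] at h4 ⊢
        simpa using h4

end

/-- Subtracting the residue gives a k-linear map from R to the cotangent space. The classes of the
`y l` extend to a basis there, and its coordinate functions composed with this map are the dual
functionals. -/
theorem IsHasseSmooth.exists_isCoordinates {k : Type u} {R : Type v} [Field k] [CommRing R]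
    [IsLocalRing R] [Algebra k R] (hS : IsHasseSmooth k R) {N : ℕ} (y : Fin N → R)
    (hy : ∀ l, y l ∈ maximalIdeal R)
    (hind : ∀ c : Fin N → k, ∑ l, c l • y l ∈ maximalIdeal R ^ 2 → c = 0) :
    ∃ (d : ℕ) (z : Fin d → R), IsCoordinates k (Sum.elim y z) := by
  classical
  have := hS.isNoetherianRing
  choose ε hε using hS.exists_sub_mem
  have hε0 : ∀ c : k, algebraMap k R c ∈ maximalIdeal R → c = 0 := by
    intro c hc
    by_contra h
    exact hc ((IsUnit.mk0 c h).map (algebraMap k R))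
  have hεu : ∀ f c, f - algebraMap k R c ∈ maximalIdeal R → ε f = c := by
    intro f c hc
    have := sub_mem hc (hε f)
    rw [sub_sub_sub_cancel_left, ← map_sub] at this
    exact sub_eq_zero.mp (hε0 _ this)
  let V := (maximalIdeal R).Cotangent
  let π : R →ₗ[k] V :=
    { toFun := fun f => (maximalIdeal R).toCotangent ⟨f - algebraMap k R (ε f), hε f⟩
      map_add' := fun f g => by
        rw [← map_add]
        congr 1
        ext
        change f + g - algebraMap k R (ε (f + g)) =
          f - algebraMap k R (ε f) + (g - algebraMap k R (ε g))
        rw [hεu (f + g) (ε f + ε g)]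
        · rw [map_add]; ring
        · have := add_mem (hε f) (hε g)
          rw [map_add]; convert this using 1; ring
      map_smul' := fun c f => by
        rw [RingHom.id_apply, ← algebraMap_smul R c ((maximalIdeal R).toCotangent _), ← map_smul]
        congr 1
        ext
        have e1 : c • f - algebraMap k R (c * ε f) =
            algebraMap k R c * (f - algebraMap k R (ε f)) := by
          rw [Algebra.smul_def, map_mul]; ring
        change c • f - algebraMap k R (ε (c • f)) = algebraMap k R c * (f - algebraMap k R (ε f))
        rw [hεu (c • f) (c * ε f)]
        · exact e1
        · rw [e1]; exact Ideal.mul_mem_left _ _ (hε f) }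
  have hπ : ∀ f (hf : f ∈ maximalIdeal R), π f = (maximalIdeal R).toCotangent ⟨f, hf⟩ := by
    intro f hf
    change (maximalIdeal R).toCotangent _ = _
    congr 1
    ext
    simp [hεu f 0 (by simpa using hf)]
  have hπ0 : ∀ f ∈ maximalIdeal R, π f = 0 ↔ f ∈ maximalIdeal R ^ 2 := by
    intro f hf
    rw [hπ f hf, Ideal.toCotangent_eq_zero]
  have hsm : ∀ (c : k), ∀ f ∈ maximalIdeal R, c • f ∈ maximalIdeal R :=
    fun c f hf => Submodule.smul_of_tower_mem _ c hf
  have hli : LinearIndependent k fun l => π (y l) := by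
    rw [Fintype.linearIndependent_iff]
    intro c hc l
    simp_rw [← map_smul] at hc
    rw [← map_sum, hπ0 _ (Ideal.sum_mem _ fun l _ => hsm _ _ (hy l))] at hc
    exact congrFun (hind c hc) l
  have : Module.Finite k V := by
    have h1 : Module.Finite R V :=
      Module.Finite.of_surjective _ (maximalIdeal R).toCotangent_surjective
    obtain ⟨s, hs⟩ := h1.fg_top
    refine ⟨⟨s, eq_top_iff.mpr fun v _ => ?_⟩⟩
    have hv : v ∈ Submodule.span R (s : Set V) := hs ▸ Submodule.mem_top
    induction hv using Submodule.span_induction with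
    | mem v hv => exact Submodule.subset_span hv
    | zero => exact zero_mem _
    | add v w _ _ hv hw => exact add_mem (hv trivial) (hw trivial)
    | smul r v _ hv =>
      obtain ⟨w, rfl⟩ := (maximalIdeal R).toCotangent_surjective v
      have : r • (maximalIdeal R).toCotangent w = ε r • (maximalIdeal R).toCotangent w := by
        rw [← algebraMap_smul R (ε r) ((maximalIdeal R).toCotangent w), ← sub_eq_zero, ← sub_smul,
          ← map_smul, Ideal.toCotangent_eq_zero, pow_two]
        exact Ideal.mul_mem_mul (hε r) w.2
      rw [this]
      exact Submodule.smul_mem _ _ (hv trivial)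
  let b₀ := Module.Basis.sumExtend hli
  have hfin : Finite (Fin N ⊕ Module.Basis.sumExtendIndex hli) := Module.Finite.finite_basis b₀
  have hfin' : Finite (Module.Basis.sumExtendIndex hli) :=
    Finite.of_injective (Sum.inr : _ → Fin N ⊕ Module.Basis.sumExtendIndex hli) Sum.inr_injective
  obtain ⟨d, ⟨eq⟩⟩ := Finite.exists_equiv_fin (Module.Basis.sumExtendIndex hli)
  let b : Module.Basis (Fin N ⊕ Fin d) k V := b₀.reindex (Equiv.sumCongr (Equiv.refl _) eq)
  have hbl : ∀ l, b (Sum.inl l) = π (y l) := by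
    intro l
    simp [b, b₀, Module.Basis.sumExtend]
    rfl
  choose w hw using (maximalIdeal R).toCotangent_surjective
  let z : Fin d → R := fun j => (w (b (Sum.inr j))).1
  have hz : ∀ j, z j ∈ maximalIdeal R := fun j => (w (b (Sum.inr j))).2
  have hmem : ∀ i, (Sum.elim y z) i ∈ maximalIdeal R := by
    rintro (l | j)
    · exact hy l
    · exact hz j
  have hb : ∀ i, π (Sum.elim y z i) = b i := by
    rintro (l | j)
    · exact (hbl l).symm
    · rw [Sum.elim_inr, hπ _ (hz j)]
      exact hw _
  refine ⟨d, z, hmem, fun f hf => ⟨fun i => b.repr (π f) i, ?_⟩, fun i =>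
    ⟨b.coord i ∘ₗ π, ?_, fun f hf => ?_, fun j => ?_⟩⟩
  · rw [← hπ0 _ (sub_mem hf (Ideal.sum_mem _ fun i _ => hsm _ _ (hmem i))), map_sub, map_sum]
    simp_rw [map_smul, hb]
    rw [b.sum_repr, sub_self]
  · have : π 1 = 0 := by
      change (maximalIdeal R).toCotangent _ = 0
      rw [Ideal.toCotangent_eq_zero]
      simp [hεu 1 1 (by simp)]
    simp [this]
  · rw [LinearMap.comp_apply, (hπ0 f (Ideal.pow_le_self two_ne_zero hf)).mpr hf, map_zero]
  · rw [LinearMap.comp_apply, hb]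
    simp [Finsupp.single_apply]

/-! ### Initial forms and the roots of the `h l` -/

section Graded

variable {R : Type v} [CommRing R] (J : Ideal R)

theorem grClass_pow (n b : ℕ) (f : R) (hf : f ∈ J ^ n) :
    grClass J n f hf ^ b = grClass J (n * b) (f ^ b) (by rw [pow_mul]; exact Ideal.pow_mem_pow hf b) := by
  rw [grClass, grClass, ← map_pow]
  congr 1
  ext1
  simp [Polynomial.monomial_pow]

theorem sub_mem_of_grClass_eq {n : ℕ} {f g : R} {hf : f ∈ J ^ n} {hg : g ∈ J ^ n}
    (h : grClass J n f hf = grClass J n g hg) : f - g ∈ J ^ (n + 1) := by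
  rw [← grClass_eq_zero_iff J n (f - g) (sub_mem hf hg), ← sub_eq_zero.mpr h, grClass, grClass,
    grClass, ← map_sub]
  congr 1
  ext1
  simp

theorem sum_smul_grClass {k : Type u} [Field k] [Algebra k R] {σ : Type} [Fintype σ] (n : ℕ)
    (c : σ → k) (y : σ → R) (hy : ∀ i, y i ∈ J ^ n) :
    ∑ i, c i • grClass J n (y i) (hy i) = grClass J n (∑ i, c i • y i)
      (Ideal.sum_mem _ fun i _ => Submodule.smul_of_tower_mem _ (c i) (hy i)) := by
  have h1 : ∀ i, c i • grClass J n (y i) (hy i) = Ideal.Quotient.mk (reesShift J)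
      (c i • ⟨Polynomial.monomial n (y i), reesAlgebra.monomial_mem.mpr (hy i)⟩) := fun i => rfl
  simp_rw [h1]
  rw [← map_sum, grClass]
  congr 1
  ext1
  change _ = Polynomial.monomial n (∑ i, c i • y i)
  rw [AddSubmonoidClass.coe_finsetSum, map_sum]
  refine Finset.sum_congr rfl fun i _ => ?_
  change c i • Polynomial.monomial n (y i) = _
  rw [Polynomial.smul_monomial]

theorem nontrivial_gr (hJ : J ≠ ⊤) : Nontrivial (Gr J) := by
  refine Ideal.Quotient.nontrivial_iff.mpr fun h => hJ ?_
  have h1 : (1 : reesAlgebra J) ∈ reesShift J := h ▸ Submodule.mem_top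
  have h2 : ((1 : reesAlgebra J) : Polynomial R).coeff 0 ∈ J ^ (0 + 1) := h1 0
  rw [Ideal.eq_top_iff_one]
  simpa using h2

end Graded

/-- For independence, apply Frobenius: a relation Σ c_l y_l = 0 in G_1, raised to the power p^{e_N},
becomes a relation with coefficients c_l^{p^{e_N}} among the powers occurring in (ii) for the
largest exponent e_N. -/
theorem IsPureSystem.exists_roots {k : Type u} {R : Type v} [Field k] [CommRing R] [IsLocalRing R]
    [Algebra k R] {p : ℕ} [ExpChar k p] {N : ℕ} {h : Fin N → R} {e : Fin N → ℕ}
    (hH : IsPureSystem k p h e) : ∃ y : Fin N → R, (∀ l, y l ∈ maximalIdeal R) ∧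
      (∀ l, h l - y l ^ p ^ e l ∈ maximalIdeal R ^ (p ^ e l + 1)) ∧
      ∀ c : Fin N → k, ∑ l, c l • y l ∈ maximalIdeal R ^ 2 → c = 0 := by
  choose y hy hgr using hH.pure
  refine ⟨y, fun l => by simpa using hy l, fun l => ?_, fun c hc => ?_⟩
  · have h1 := hgr l
    have hmem : y l ^ p ^ e l ∈ maximalIdeal R ^ (p ^ e l) :=
      Ideal.pow_mem_pow (by simpa using hy l) _
    refine sub_mem_of_grClass_eq _ (hf := hH.mem l) (hg := hmem) (h1.trans ?_)
    rw [grClass_pow]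
    congr 1
    rw [one_mul]
  · have := nontrivial_gr (maximalIdeal R) (Ideal.IsPrime.ne_top')
    have : ExpChar (Gr (maximalIdeal R)) p :=
      expChar_of_injective_algebraMap (algebraMap k (Gr (maximalIdeal R))).injective p
    cases N with
    | zero => exact Subsingleton.elim _ _
    | succ N =>
      have hle : ∀ l, e l ≤ e (Fin.last N) := fun l => hH.mono (Fin.le_last l)
      have hli := (hH.linearIndependent (Fin.last N)).comp
        (fun l : Fin (N + 1) => (⟨l, hle l⟩ : {l : Fin (N + 1) // e l ≤ e (Fin.last N)}))
        (fun a b hab => congrArg Subtype.val hab)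
      have h0 : ∑ l, c l • grClass (maximalIdeal R) 1 (y l) (hy l) = 0 := by
        rw [sum_smul_grClass, grClass_eq_zero_iff]
        exact hc
      have h1 : ∑ l, (c l ^ p ^ e (Fin.last N)) •
          grClass (maximalIdeal R) 1 (y l) (hy l) ^ p ^ e (Fin.last N) = 0 := by
        simp_rw [← smul_pow]
        refine (sum_pow_char_pow p (e (Fin.last N)) Finset.univ
          (fun l => c l • grClass (maximalIdeal R) 1 (y l) (hy l))).symm.trans ?_
        rw [h0]
        exact zero_pow (pow_ne_zero _ (expChar_pos k p).ne')
      rw [Fintype.linearIndependent_iff] at hli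
      ext l
      refine pow_eq_zero_iff (pow_ne_zero (e (Fin.last N)) (expChar_pos k p).ne') |>.mp
        (hli (fun l => c l ^ p ^ e (Fin.last N)) ?_ l)
      rw [← h1]
      refine Finset.sum_congr rfl fun l _ => ?_
      simp only [Function.comp_apply]
      rw [hgr l, ← pow_mul, ← pow_add, Nat.add_sub_cancel' (hle l)]

section Leading

variable {R : Type v} [CommRing R] {m : Ideal R}

theorem mul_sub_mul_mem_pow {r s : ℕ} {a a' b b' : R} (ha' : a' ∈ m ^ r)
    (ha : a - a' ∈ m ^ (r + 1)) (hb' : b' ∈ m ^ s) (hb : b - b' ∈ m ^ (s + 1)) :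
    a * b - a' * b' ∈ m ^ (r + s + 1) := by
  have hbs : b ∈ m ^ s := by
    have := add_mem (Ideal.pow_le_pow_right (Nat.le_succ s) hb) hb'
    simpa using this
  have e1 : a * b - a' * b' = (a - a') * b + a' * (b - b') := by ring
  rw [e1]
  refine add_mem ?_ ?_
  · have := Ideal.mul_mem_mul ha hbs
    rw [← pow_add] at this
    convert this using 2; ring
  · have := Ideal.mul_mem_mul ha' hb
    rwa [← pow_add, ← add_assoc] at this

theorem pow_sub_pow_mem_pow {r : ℕ} {a a' : R} (ha' : a' ∈ m ^ r) (ha : a - a' ∈ m ^ (r + 1))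
    (b : ℕ) : a ^ b - a' ^ b ∈ m ^ (b * r + 1) := by
  induction b with
  | zero => simp
  | succ b ih =>
    have h1 : a' ^ b ∈ m ^ (b * r) := by
      rw [mul_comm, pow_mul]; exact Ideal.pow_mem_pow ha' b
    have := mul_sub_mul_mem_pow h1 ih ha' ha
    rwa [pow_succ a, pow_succ a', Nat.add_one_mul]

theorem prod_sub_prod_mem_pow {τ : Type} (S : Finset τ) (r : τ → ℕ) {a a' : τ → R}
    (ha' : ∀ i ∈ S, a' i ∈ m ^ r i) (ha : ∀ i ∈ S, a i - a' i ∈ m ^ (r i + 1)) :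
    ∏ i ∈ S, a i - ∏ i ∈ S, a' i ∈ m ^ (∑ i ∈ S, r i + 1) := by
  classical
  induction S using Finset.induction_on with
  | empty => simp
  | insert i S hi ih =>
    rw [Finset.prod_insert hi, Finset.prod_insert hi, Finset.sum_insert hi]
    refine mul_sub_mul_mem_pow (ha' i (by simp)) (ha i (by simp)) ?_
      (ih (fun j hj => ha' j (by simp [hj])) fun j hj => ha j (by simp [hj]))
    rw [← Finset.prod_pow_eq_pow_sum]
    exact Ideal.prod_mem_prod fun j hj => ha' j (by simp [hj])

end Leading

/-! ### Normal monomials and their independence -/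

section Exponents

variable {N d : ℕ} (q : Fin N → ℕ)

/-- Exponents of the `h l` in the normal form of the monomial with exponent `J`. -/
def quotExp (J : Fin N ⊕ Fin d → ℕ) : Fin N → ℕ := fun l => J (Sum.inl l) / q l

/-- Exponents of the coordinates in the normal form of the monomial with exponent `J`. -/
def remExp (J : Fin N ⊕ Fin d → ℕ) : Fin N ⊕ Fin d → ℕ :=
  Sum.elim (fun l => J (Sum.inl l) % q l) fun j => J (Sum.inr j)

/-- The exponent of the leading monomial of `∏ h l ^ B l`. -/
def leadExp (B : Fin N → ℕ) : Fin N ⊕ Fin d → ℕ := Sum.elim (fun l => B l * q l) 0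

theorem sum_leadExp (B : Fin N → ℕ) : ∑ i, leadExp (d := d) q B i = ∑ l, B l * q l := by
  simp [leadExp, Fintype.sum_sum_type]

theorem remExp_add_leadExp (J : Fin N ⊕ Fin d → ℕ) :
    remExp q J + leadExp q (quotExp q J) = J := by
  ext (l | j)
  · simp [remExp, leadExp, quotExp, Nat.mod_add_div']
  · simp [remExp, leadExp]

theorem sum_remExp_add (J : Fin N ⊕ Fin d → ℕ) :
    ∑ i, remExp q J i + ∑ l, quotExp q J l * q l = ∑ i, J i := by
  conv_rhs => rw [← remExp_add_leadExp q J]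
  simp only [Pi.add_apply, Finset.sum_add_distrib, sum_leadExp]

theorem sub_leadExp (J : Fin N ⊕ Fin d → ℕ) : J - leadExp q (quotExp q J) = remExp q J := by
  nth_rw 1 [← remExp_add_leadExp q J]
  exact add_tsub_cancel_right _ _

variable {q}

theorem quotExp_remExp (J : Fin N ⊕ Fin d → ℕ) : quotExp q (remExp q J) = 0 := by
  ext l
  simp [quotExp, remExp]

theorem quotExp_add_leadExp (hq : ∀ l, 0 < q l) (J : Fin N ⊕ Fin d → ℕ) (B : Fin N → ℕ) :
    quotExp q (J + leadExp q B) = quotExp q J + B := by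
  ext l
  simp [quotExp, leadExp, Nat.add_mul_div_right _ _ (hq l)]

theorem remExp_add_leadExp_right (J : Fin N ⊕ Fin d → ℕ) (B : Fin N → ℕ) :
    remExp q (J + leadExp q B) = remExp q J := by
  ext (l | j)
  · simp [remExp, leadExp]
  · simp [remExp, leadExp]

theorem remExp_remExp (J : Fin N ⊕ Fin d → ℕ) : remExp q (remExp q J) = remExp q J := by
  ext (l | j)
  · simp [remExp]
  · simp [remExp]

end Exponents

/-- The monomial `x ^ J` with the largest possible powers of the `x l ^ q l` replaced by powers of
the `h l`. -/
def normalMono {R : Type v} [CommRing R] {N d : ℕ} (q : Fin N → ℕ) (x : Fin N ⊕ Fin d → R)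
    (h : Fin N → R) (J : Fin N ⊕ Fin d → ℕ) : R :=
  mono x (remExp q J) * mono h (quotExp q J)

theorem normalMono_remExp {R : Type v} [CommRing R] {N d : ℕ} (q : Fin N → ℕ)
    (x : Fin N ⊕ Fin d → R) (h : Fin N → R) (J : Fin N ⊕ Fin d → ℕ) :
    normalMono q x h (remExp q J) = mono x (remExp q J) := by
  rw [normalMono, remExp_remExp, quotExp_remExp, mono_zero, mul_one]

section

variable {R : Type v} [CommRing R] [IsLocalRing R] {N d : ℕ} {q : Fin N → ℕ}
  {x : Fin N ⊕ Fin d → R} {h : Fin N → R}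

theorem mono_sub_mono_leadExp_mem (hx : ∀ i, x i ∈ maximalIdeal R)
    (hh : ∀ l, h l - x (Sum.inl l) ^ q l ∈ maximalIdeal R ^ (q l + 1)) (B : Fin N → ℕ) :
    mono h B - mono x (leadExp q B) ∈ maximalIdeal R ^ (∑ l, B l * q l + 1) := by
  have e1 : mono x (leadExp q B) = ∏ l, (x (Sum.inl l) ^ q l) ^ B l := by
    simp [mono, leadExp, Fintype.prod_sum_type, ← pow_mul, mul_comm]
  rw [e1, mono]
  refine prod_sub_prod_mem_pow _ _ (fun l _ => ?_) fun l _ =>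
    pow_sub_pow_mem_pow (Ideal.pow_mem_pow (hx _) _) (hh l) _
  rw [← pow_mul, mul_comm]
  exact Ideal.pow_mem_pow (hx _) _

theorem normalMono_sub_mono_mem (hx : ∀ i, x i ∈ maximalIdeal R)
    (hh : ∀ l, h l - x (Sum.inl l) ^ q l ∈ maximalIdeal R ^ (q l + 1))
    (J : Fin N ⊕ Fin d → ℕ) :
    normalMono q x h J - mono x J ∈ maximalIdeal R ^ (∑ i, J i + 1) := by
  have h1 := mono_mem_pow hx (leadExp q (quotExp q J))
  rw [sum_leadExp] at h1
  have := mul_sub_mul_mem_pow (mono_mem_pow hx (remExp q J))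
    (show mono x (remExp q J) - mono x (remExp q J) ∈ _ by rw [sub_self]; exact zero_mem _) h1
    (mono_sub_mono_leadExp_mem hx hh (quotExp q J))
  rwa [← mono_add, remExp_add_leadExp, sum_remExp_add] at this

theorem normalMono_mem_pow (hx : ∀ i, x i ∈ maximalIdeal R)
    (hh : ∀ l, h l - x (Sum.inl l) ^ q l ∈ maximalIdeal R ^ (q l + 1))
    (J : Fin N ⊕ Fin d → ℕ) : normalMono q x h J ∈ maximalIdeal R ^ ∑ i, J i := by
  have := add_mem (Ideal.pow_le_pow_right (Nat.le_succ _) (normalMono_sub_mono_mem hx hh J))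
    (mono_mem_pow hx J)
  simpa using this

theorem mono_mem_pow_of_sub (hx : ∀ i, x i ∈ maximalIdeal R)
    (hh : ∀ l, h l - x (Sum.inl l) ^ q l ∈ maximalIdeal R ^ (q l + 1)) (B : Fin N → ℕ) :
    mono h B ∈ maximalIdeal R ^ ∑ l, B l * q l := by
  have h1 := mono_mem_pow hx (leadExp q B)
  rw [sum_leadExp] at h1
  have := add_mem (Ideal.pow_le_pow_right (Nat.le_succ _) (mono_sub_mono_leadExp_mem hx hh B)) h1
  simpa using this

variable {k : Type u} [Field k] [Algebra k R]

theorem IsHasseSmooth.mem_span_mono (hS : IsHasseSmooth k R) (hx : IsCoordinates k x) (r : ℕ) :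
    ∀ f ∈ maximalIdeal R ^ r, f ∈ Submodule.span k (mono x '' {J | ∑ i, J i = r}) ⊔
      (maximalIdeal R ^ (r + 1)).restrictScalars k := by
  induction r with
  | zero =>
    intro f _
    obtain ⟨c, hc⟩ := hS.exists_sub_mem f
    rw [← add_sub_cancel (algebraMap k R c) f]
    refine Submodule.add_mem_sup ?_ (by simpa using hc)
    rw [Algebra.algebraMap_eq_smul_one, ← mono_zero x]
    exact Submodule.smul_mem _ _ (Submodule.subset_span ⟨0, by simp, rfl⟩)
  | succ r ih =>
    intro f hf
    rw [pow_succ'] at hf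
    refine Submodule.mul_induction_on hf (fun u hu v hv => ?_) fun a b ha hb => add_mem ha hb
    obtain ⟨c, hc⟩ := hx.exists_sub_mem u hu
    obtain ⟨v₁, hv₁, v₂, hv₂, rfl⟩ := Submodule.mem_sup.mp (ih v hv)
    have e1 : u * (v₁ + v₂) = ∑ i, c i • (x i * v₁) +
        ((∑ i, c i • x i) * v₂ + (u - ∑ i, c i • x i) * (v₁ + v₂)) := by
      simp_rw [← smul_mul_assoc]
      rw [← Finset.sum_mul]; ring
    rw [e1]
    refine Submodule.add_mem_sup (Submodule.sum_mem _ fun i _ => Submodule.smul_mem _ _ ?_)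
      (add_mem ?_ ?_)
    · have hle : Submodule.span k (mono x '' {J | ∑ i, J i = r}) ≤
          (Submodule.span k (mono x '' {J | ∑ i, J i = r + 1})).comap
            (LinearMap.mulLeft k (x i)) := by
        refine Submodule.span_le.mpr ?_
        rintro _ ⟨J, hJ, rfl⟩
        refine Submodule.subset_span ⟨Pi.single i 1 + J, ?_, ?_⟩
        · simp only [Set.mem_ofPred_eq, Pi.add_apply, Finset.sum_add_distrib,
            Finset.sum_pi_single', Finset.mem_univ, if_true]
          rw [show ∑ i, J i = r from hJ, add_comm]
        · rw [mono_add, mono_single, pow_one]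
          rfl
      exact hle hv₁
    · rw [Submodule.restrictScalars_mem, pow_succ']
      exact Ideal.mul_mem_mul (Ideal.sum_mem _ fun i _ =>
        Submodule.smul_of_tower_mem _ _ (hx.mem i)) hv₂
    · have := Ideal.mul_mem_mul hc hv
      rw [← pow_add] at this
      rw [Submodule.restrictScalars_mem]
      convert this using 2; ring

theorem IsHasseSmooth.mem_span_normalMono (hS : IsHasseSmooth k R) (hx : IsCoordinates k x)
    (hh : ∀ l, h l - x (Sum.inl l) ^ q l ∈ maximalIdeal R ^ (q l + 1)) (r : ℕ) :
    ∀ f ∈ maximalIdeal R ^ r, f ∈ Submodule.span k (normalMono q x h '' {J | ∑ i, J i = r}) ⊔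
      (maximalIdeal R ^ (r + 1)).restrictScalars k := by
  intro f hf
  refine (sup_le (Submodule.span_le.mpr ?_) le_sup_right :
    Submodule.span k (mono x '' {J | ∑ i, J i = r}) ⊔
      (maximalIdeal R ^ (r + 1)).restrictScalars k ≤ _) (hS.mem_span_mono hx r f hf)
  rintro _ ⟨J, hJ, rfl⟩
  rw [← add_sub_cancel (normalMono q x h J) (mono x J)]
  refine Submodule.add_mem_sup (Submodule.subset_span ⟨J, hJ, rfl⟩) ?_
  rw [Submodule.restrictScalars_mem, ← neg_sub, ← show ∑ i, J i = r from hJ]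
  exact neg_mem (normalMono_sub_mono_mem hx.mem hh J)

theorem IsHasseSmooth.mem_span_range_normalMono (hS : IsHasseSmooth k R) (hx : IsCoordinates k x)
    (hh : ∀ l, h l - x (Sum.inl l) ^ q l ∈ maximalIdeal R ^ (q l + 1)) (n : ℕ) (f : R) :
    f ∈ Submodule.span k (Set.range (normalMono q x h)) ⊔
      (maximalIdeal R ^ n).restrictScalars k := by
  induction n with
  | zero => exact Submodule.mem_sup_right (by simp)
  | succ n ih =>
    obtain ⟨a, ha, b, hb, rfl⟩ := Submodule.mem_sup.mp ih
    refine add_mem (Submodule.mem_sup_left ha) ?_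
    exact (sup_le ((Submodule.span_mono (Set.image_subset_range _ _)).trans le_sup_left)
      le_sup_right : _ ≤ Submodule.span k (Set.range (normalMono q x h)) ⊔
        (maximalIdeal R ^ (n + 1)).restrictScalars k) (hS.mem_span_normalMono hx hh n b hb)

/-- For a nonzero term of least degree, the operator with exponent J sends its normal monomial to 1
modulo 𝔪 and every other term into 𝔪, which leaves c_J in 𝔪. -/
theorem IsHasseSmooth.coeff_eq_zero (hS : IsHasseSmooth k R) (hx : IsCoordinates k x)
    (hh : ∀ l, h l - x (Sum.inl l) ^ q l ∈ maximalIdeal R ^ (q l + 1))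
    (c : (Fin N ⊕ Fin d → ℕ) →₀ k) (n : ℕ)
    (hc : Finsupp.linearCombination k (normalMono q x h) c ∈ maximalIdeal R ^ n) :
    ∀ J, ∑ i, J i < n → c J = 0 := by
  intro J
  induction hs : ∑ i, J i using Nat.strong_induction_on generalizing J with
  | _ s ih =>
  intro hJn
  by_contra hcJ
  obtain ⟨D, -, hD, hDm⟩ := hS.exists_operator hx J
  have h1 := hD n 1 _ hc (by omega)
  rw [Finsupp.linearCombination_apply, Finsupp.sum, map_sum,
    ← Finset.add_sum_erase _ _ (Finsupp.mem_support_iff.mpr hcJ)] at h1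
  have h2 : ∑ J' ∈ c.support.erase J, D (c J' • normalMono q x h J') ∈ maximalIdeal R ^ 1 := by
    refine Ideal.sum_mem _ fun J' hJ' => ?_
    obtain ⟨hne, hJ's⟩ := Finset.mem_erase.mp hJ'
    rw [map_smul]
    refine Submodule.smul_of_tower_mem _ _ ?_
    rcases lt_trichotomy (∑ i, J' i) s with hlt | heq | hgt
    · exact absurd (ih _ hlt J' rfl (by omega)) (Finsupp.mem_support_iff.mp hJ's)
    · have h3 := hD _ 1 _ (normalMono_sub_mono_mem hx.mem hh J') (by omega)
      have h4 := hDm J' 1 (by omega)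
      -- Distinct exponents of equal degree: some entry of J' is smaller, and its binomial
      -- coefficient vanishes.
      obtain ⟨i, hi⟩ : ∃ i, J' i < J i := by
        by_contra! hle
        refine hne (funext fun i => ?_)
        exact ((Finset.sum_eq_sum_iff_of_le fun i _ => hle i).mp (hs.trans heq.symm) i
          (Finset.mem_univ i)).symm
      rw [Finset.prod_eq_zero (Finset.mem_univ i) (Nat.choose_eq_zero_of_lt hi), Nat.cast_zero,
        zero_mul, sub_zero] at h4
      rw [map_sub] at h3
      simpa using add_mem h3 h4
    · exact hD _ 1 _ (normalMono_mem_pow hx.mem hh J') (by omega)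
  have h3 := hD _ 1 _ (normalMono_sub_mono_mem hx.mem hh J) (by omega)
  have h4 := hDm J 1 (by omega)
  have h5 : J - J = 0 := by ext; simp
  simp only [Nat.choose_self, Finset.prod_const_one, Nat.cast_one, one_mul, h5, mono_zero] at h4
  rw [map_sub] at h3
  have h6 : D (normalMono q x h J) - 1 ∈ maximalIdeal R ^ 1 := by
    simpa using add_mem h3 h4
  have h7 : D (c J • normalMono q x h J) ∈ maximalIdeal R ^ 1 := by
    simpa using sub_mem h1 h2
  have h8 := Submodule.smul_of_tower_mem (maximalIdeal R ^ 1) (c J) h6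
  rw [map_smul] at h7
  rw [smul_sub] at h8
  have h9 := sub_mem h7 h8
  rw [sub_sub_cancel, pow_one, ← Algebra.algebraMap_eq_smul_one] at h9
  exact h9 ((IsUnit.mk0 _ hcJ).map (algebraMap k R))

/-- Multiplication by h_l permits no reduction: it turns a normal monomial into the one whose
exponent at l is larger by q_l. -/
theorem IsHasseSmooth.ideal_span_le (hS : IsHasseSmooth k R) (hx : IsCoordinates k x)
    (hh : ∀ l, h l - x (Sum.inl l) ^ q l ∈ maximalIdeal R ^ (q l + 1)) (hq : ∀ l, 0 < q l)
    (n : ℕ) : (Ideal.span (Set.range h)).restrictScalars k ≤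
      Submodule.span k (normalMono q x h '' {J | quotExp q J ≠ 0}) ⊔
      (maximalIdeal R ^ n).restrictScalars k := by
  intro f hf
  rw [Submodule.restrictScalars_mem, Ideal.mem_span_range_iff_exists_fun] at hf
  obtain ⟨c, rfl⟩ := hf
  refine Submodule.sum_mem _ fun l _ => ?_
  obtain ⟨a, ha, b, hb, hab⟩ := Submodule.mem_sup.mp (hS.mem_span_range_normalMono hx hh n (c l))
  rw [← hab, add_mul]
  refine Submodule.add_mem_sup ?_ (Ideal.mul_mem_right _ _ hb)
  clear hab
  have hle : Submodule.span k (Set.range (normalMono q x h)) ≤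
      (Submodule.span k (normalMono q x h '' {J | quotExp q J ≠ 0})).comap
        (LinearMap.mulRight k (h l)) := by
    refine Submodule.span_le.mpr ?_
    rintro _ ⟨J, rfl⟩
    refine Submodule.subset_span ⟨J + leadExp q (Pi.single l 1), ?_, ?_⟩
    · rw [Set.mem_ofPred_eq, quotExp_add_leadExp hq]
      intro h0
      have := congrFun h0 l
      simp at this
    · rw [normalMono, remExp_add_leadExp_right, quotExp_add_leadExp hq, mono_add, mono_single, pow_one,
        ← mul_assoc]
      rfl
  exact hle ha

/-- Modulo 𝔪^{s+1}, the ideal (ℋ) contributes only normal monomials with nonzero h-exponent, which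
cannot cancel terms free of h. -/
theorem IsHasseSmooth.eq_zero_of_mem_sup (hS : IsHasseSmooth k R) (hx : IsCoordinates k x)
    (hh : ∀ l, h l - x (Sum.inl l) ^ q l ∈ maximalIdeal R ^ (q l + 1)) (hq : ∀ l, 0 < q l)
    {s : ℕ} (c : (Fin N ⊕ Fin d → ℕ) →₀ k)
    (hcs : ∀ J ∈ c.support, ∑ i, J i = s ∧ quotExp q J = 0)
    (hc : Finsupp.linearCombination k (normalMono q x h) c ∈
      maximalIdeal R ^ (s + 1) ⊔ Ideal.span (Set.range h)) : c = 0 := by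
  obtain ⟨a, ha, b, hb, hab⟩ := Submodule.mem_sup.mp hc
  obtain ⟨w, hw, b', hb', rfl⟩ := Submodule.mem_sup.mp (hS.ideal_span_le hx hh hq (s + 1) hb)
  obtain ⟨c', hc', rfl⟩ := (Finsupp.mem_span_image_iff_linearCombination k).mp hw
  have h1 := hS.coeff_eq_zero hx hh (c - c') (s + 1) (by
    rw [map_sub, ← hab]
    have := add_mem ha hb'
    convert this using 1; ring)
  ext J
  by_contra hJ
  obtain ⟨hJs, hJ0⟩ := hcs J (Finsupp.mem_support_iff.mpr hJ)
  have h2 : c' J = 0 := by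
    by_contra h3
    exact hc' (Finsupp.mem_support_iff.mpr h3) hJ0
  have h3 := h1 J (by omega)
  rw [Finsupp.sub_apply, h2, sub_zero] at h3
  exact hJ h3

end

/-! ### Lucas' congruence, the condition on μ, and powers in the filtration -/

/-- The lower number has the base p digits of n from place e on and zeros below, so every factor in
Lucas' theorem is 1. -/
theorem choose_mul_div_modEq_one (p e n : ℕ) [hp : Fact p.Prime] :
    n.choose (n / p ^ e * p ^ e) ≡ 1 [MOD p] := by
  induction e generalizing n with
  | zero => simp [Nat.ModEq.refl]
  | succ e ih =>
    refine (Choose.choose_modEq_choose_mod_mul_choose_div_nat (p := p)).trans ?_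
    have e1 : n / p ^ (e + 1) * p ^ (e + 1) = (n / p / p ^ e * p ^ e) * p := by
      rw [pow_succ', Nat.div_div_eq_div_mul]; ring
    rw [e1, Nat.mul_mod_left, Nat.mul_div_cancel _ hp.out.pos, Nat.choose_zero_right, one_mul]
    exact ih _

theorem cast_choose_mul_div (R : Type v) [CommRing R] (p e n : ℕ) [ExpChar R p] :
    ((n.choose (n / p ^ e * p ^ e) : ℕ) : R) = 1 := by
  rcases ‹ExpChar R p› with _ | hp
  · simp
  · have := Fact.mk hp
    have := (CharP.natCast_eq_natCast R p).mpr (choose_mul_div_modEq_one p e n)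
    simpa using this

theorem pow_sup_le_pow_sup {R : Type v} [CommRing R] (m K : Ideal R) {i j : ℕ} (hij : i ≤ j) :
    m ^ j ⊔ K ≤ m ^ i ⊔ K :=
  sup_le ((Ideal.pow_le_pow_right hij).trans le_sup_left) le_sup_right

/-- Otherwise, with n the ceiling, ord_ℋ(f) ≤ n − 1 < μa, against μ < ord_ℋ(f)/a. -/
theorem mem_pow_sup_of_lt_muMod {R : Type v} [CommRing R] [IsLocalRing R] {N : ℕ} {h : Fin N → R}
    {I : IdealisticFiltration R} {μ : ℝ} (hμ0 : 0 ≤ μ) (hμ : ENNReal.ofReal μ < muMod h I)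
    {f : R} {a : ℝ} (hf : f ∈ I.level a) (ha : 0 < a) :
    f ∈ maximalIdeal R ^ ⌈μ * a⌉₊ ⊔ Ideal.span (Set.range h) := by
  have h1 : ENNReal.ofReal μ < (ordMod h f : ℝ≥0∞) / ENNReal.ofReal a :=
    hμ.trans_le (sInf_le ⟨f, a, hf, ha, rfl⟩)
  have ha0 : ENNReal.ofReal a ≠ 0 := by simpa using ha
  rw [ENNReal.lt_div_iff_mul_lt (Or.inl ha0) (Or.inl ENNReal.ofReal_ne_top),
    ← ENNReal.ofReal_mul hμ0] at h1
  by_contra hcon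
  set n := ⌈μ * a⌉₊ with hn
  have hn0 : n ≠ 0 := by
    intro h0
    rw [h0] at hcon
    simp at hcon
  have h2 : ordMod h f ≤ ((n - 1 : ℕ) : ℕ∞) := by
    refine sSup_le ?_
    rintro _ ⟨j, rfl, hj⟩
    rw [Nat.cast_le]
    by_contra hlt
    exact hcon (pow_sup_le_pow_sup _ _ (show n ≤ j by omega) hj)
  have h3 : ((n - 1 : ℕ) : ℝ) < μ * a := Nat.lt_ceil.mp (by omega)
  have h4 : (ordMod h f : ℝ≥0∞) ≤ ENNReal.ofReal (μ * a) := by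
    calc (ordMod h f : ℝ≥0∞) ≤ (((n - 1 : ℕ) : ℕ∞) : ℝ≥0∞) := by exact_mod_cast h2
      _ = ENNReal.ofReal ((n - 1 : ℕ) : ℝ) := by simp
      _ ≤ _ := ENNReal.ofReal_le_ofReal h3.le
  exact absurd h1 (not_lt.mpr h4)

theorem IdealisticFiltration.level_eq_top {R : Type v} [CommRing R] (I : IdealisticFiltration R)
    {a : ℝ} (ha : a ≤ 0) : I.level a = ⊤ :=
  eq_top_iff.mpr (I.level_zero ▸ I.level_antitone 0 a ha)

theorem IdealisticFiltration.pow_mem_level {R : Type v} [CommRing R] (I : IdealisticFiltration R)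
    {f : R} {w : ℕ} (hf : f ∈ I.level (w : ℕ)) (b : ℕ) : f ^ b ∈ I.level ((b * w : ℕ) : ℝ) := by
  induction b with
  | zero => rw [I.level_eq_top (by simp)]; trivial
  | succ b ih =>
    rw [pow_succ, Nat.add_one_mul, Nat.cast_add]
    exact I.level_mul_le _ _ (Ideal.mul_mem_mul ih hf)

theorem IdealisticFiltration.mono_mem_level {R : Type v} [CommRing R] (I : IdealisticFiltration R)
    {N : ℕ} {h : Fin N → R} {q : Fin N → ℕ} (hh : ∀ l, h l ∈ I.level (q l : ℕ)) (B : Fin N → ℕ) :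
    mono h B ∈ I.level ((∑ l, B l * q l : ℕ) : ℝ) := by
  classical
  rw [mono]
  generalize (Finset.univ : Finset (Fin N)) = S
  induction S using Finset.induction_on with
  | empty => rw [I.level_eq_top (by simp)]; trivial
  | insert i S hi ih =>
    rw [Finset.prod_insert hi, Finset.sum_insert hi, Nat.cast_add]
    exact I.level_mul_le _ _ (Ideal.mul_mem_mul (I.pow_mem_level (hh i) _) ih)

/-! ### Eliminating the leading form -/

section

variable {k : Type u} {R : Type v} [Field k] [CommRing R] [IsLocalRing R] [Algebra k R]
  {N d : ℕ} {p : ℕ} {e : Fin N → ℕ} {x : Fin N ⊕ Fin d → R} {h : Fin N → R}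

/-- If J has quotient B, the binomials are 1 by Lucas and x^rem remains. Otherwise some J_l < B_l
p^{e_l}, and a binomial vanishes. -/
theorem operator_sub_mem (hp : ExpChar R p) (hx : IsCoordinates k x)
    (hh : ∀ l, h l - x (Sum.inl l) ^ p ^ e l ∈ maximalIdeal R ^ (p ^ e l + 1))
    {B : Fin N → ℕ} {D : R →ₗ[k] R}
    (hD : ∀ r s, ∀ f ∈ maximalIdeal R ^ r,
      s + ∑ i, leadExp (d := d) (fun l => p ^ e l) B i ≤ r → D f ∈ maximalIdeal R ^ s)
    (hDm : ∀ J s, s + ∑ i, leadExp (d := d) (fun l => p ^ e l) B i ≤ ∑ i, J i + 1 →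
        D (mono x J) - ((∏ i, (J i).choose (leadExp (fun l => p ^ e l) B i) : ℕ) : R) *
          mono x (J - leadExp (fun l => p ^ e l) B) ∈ maximalIdeal R ^ s)
    {s : ℕ} {J : Fin N ⊕ Fin d → ℕ}
    (hs : s + ∑ i, leadExp (d := d) (fun l => p ^ e l) B i ≤ ∑ i, J i + 1)
    (hJ : quotExp (fun l => p ^ e l) J ≠ B → ∃ l, quotExp (fun l => p ^ e l) J l < B l) :
    D (normalMono (fun l => p ^ e l) x h J) - (if quotExp (fun l => p ^ e l) J = B then
      normalMono (fun l => p ^ e l) x h (remExp (fun l => p ^ e l) J) else 0) ∈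
        maximalIdeal R ^ s := by
  have h1 := hD _ s _ (normalMono_sub_mono_mem hx.mem hh J) hs
  have h2 := hDm J s hs
  rw [map_sub] at h1
  have h3 := add_mem h1 h2
  rw [sub_add_sub_cancel] at h3
  convert h3 using 2
  split_ifs with hB
  · subst hB
    rw [sub_leadExp, normalMono_remExp]
    have : ((∏ i, (J i).choose (leadExp (fun l => p ^ e l)
        (quotExp (fun l => p ^ e l) J) i) : ℕ) : R) = 1 := by
      rw [Nat.cast_prod]
      refine Finset.prod_eq_one fun i _ => ?_
      rcases i with l | j
      · exact cast_choose_mul_div R p (e l) _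
      · simp [leadExp]
    rw [this, one_mul]
  · obtain ⟨l, hl⟩ := hJ hB
    have h4 : J (Sum.inl l) < B l * p ^ e l :=
      (Nat.div_lt_iff_lt_mul (pow_pos (expChar_pos R p) _)).mp hl
    rw [Finset.prod_eq_zero (Finset.mem_univ (Sum.inl l)) (Nat.choose_eq_zero_of_lt h4)]
    simp

/-- Induction on the number of terms in the degree r leading form c of f. -/
theorem IsHasseSmooth.mem_iSup_sup (hS : IsHasseSmooth k R) (hp : ExpChar R p)
    (hx : IsCoordinates k x)
    (hh : ∀ l, h l - x (Sum.inl l) ^ p ^ e l ∈ maximalIdeal R ^ (p ^ e l + 1))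
    {I : IdealisticFiltration R} (hI : I.IsDSaturated k)
    (hHI : ∀ l, h l ∈ I.level (p ^ e l : ℕ)) {μ : ℝ} (hμ0 : 0 ≤ μ)
    (hμ : ENNReal.ofReal μ < muMod h I) (a : ℝ) (r : ℕ) (n : ℕ) :
    ∀ c : (Fin N ⊕ Fin d → ℕ) →₀ k, c.support.card = n → (∀ J ∈ c.support, ∑ i, J i = r) →
      ∀ f ∈ I.level a,
        f - Finsupp.linearCombination k (normalMono (fun l => p ^ e l) x h) c ∈
          maximalIdeal R ^ (r + 1) →
        f ∈ (⨆ B : Fin N → ℕ, cutLevel I μ (a - (weight p e B : ℝ)) * Ideal.span {mono h B}) ⊔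
          maximalIdeal R ^ (r + 1) := by
  classical
  induction n using Nat.strong_induction_on with
  | _ n ih =>
  intro c hcn hcr f hf hfc
  set q : Fin N → ℕ := fun l => p ^ e l
  have hq : ∀ l, 0 < q l := fun l => pow_pos (expChar_pos R p) _
  rcases Finset.eq_empty_or_nonempty c.support with hemp | hne
  · rw [Finsupp.support_eq_empty.mp hemp, map_zero, sub_zero] at hfc
    exact Submodule.mem_sup_right hfc
  obtain ⟨J₁, hJ₁, hmax⟩ := Finset.exists_max_image c.support (fun J => ∑ l, quotExp q J l) hne
  set B := quotExp q J₁ with hB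
  -- By maximality of its total degree, B is not dominated by any other quotient exponent that
  -- occurs.
  have hlt : ∀ J ∈ c.support, quotExp q J ≠ B → ∃ l, quotExp q J l < B l := by
    intro J hJ hJB
    by_contra! hle
    refine hJB (funext fun l => ?_)
    have h1 := le_antisymm (hmax J hJ) (Finset.sum_le_sum fun l _ => hle l)
    exact ((Finset.sum_eq_sum_iff_of_le fun l _ => hle l).mp h1.symm l (Finset.mem_univ l)).symm
  obtain ⟨D, hDI, hD, hDm⟩ := hS.exists_operator hx (leadExp q B)
  have hw : ∑ l, B l * q l ≤ r := by
    rw [← hcr J₁ hJ₁, ← sum_remExp_add q J₁]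
    exact Nat.le_add_left _ _
  obtain ⟨s, hs⟩ := Nat.exists_eq_add_of_le hw
  have hqs : ∑ l, B l * p ^ e l = ∑ l, B l * q l := rfl
  let cB := c.filter fun J => quotExp q J = B
  let c' := c.filter fun J => ¬ quotExp q J = B
  have hcadd : cB + c' = c := Finsupp.filter_add_filter_not c _
  -- The coefficient of H^B in the leading form: the terms with h-exponent B, divided by H^B.
  let c₀ := cB.mapDomain (remExp q)
  set M := normalMono q x h with hM
  have hlc₀ : Finsupp.linearCombination k M c₀ =
      ∑ J ∈ c.support, c J • (if quotExp q J = B then M (remExp q J) else 0) := by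
    rw [Finsupp.linearCombination_mapDomain, Finsupp.linearCombination_apply, Finsupp.sum,
      Finsupp.support_filter, Finset.sum_filter]
    refine Finset.sum_congr rfl fun J _ => ?_
    split_ifs with hJ
    · exact congrArg (· • M (remExp q J))
        (Finsupp.filter_apply_pos (fun J => quotExp q J = B) c hJ)
    · simp
  have hmul : mono h B * Finsupp.linearCombination k M c₀ =
      Finsupp.linearCombination k M cB := by
    rw [Finsupp.linearCombination_mapDomain, Finsupp.linearCombination_apply,
      Finsupp.linearCombination_apply, Finsupp.sum, Finsupp.sum, Finset.mul_sum]
    refine Finset.sum_congr rfl fun J hJ => ?_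
    have hJB : quotExp q J = B := by
      rw [Finsupp.support_filter, Finset.mem_filter] at hJ
      exact hJ.2
    rw [mul_smul_comm, Function.comp_apply, hM, normalMono_remExp, normalMono, hJB, mul_comm]
  have hgc : D f - Finsupp.linearCombination k M c₀ ∈ maximalIdeal R ^ (s + 1) := by
    have h1 := hD _ (s + 1) _ hfc (by rw [sum_leadExp]; omega)
    have h2 : D (Finsupp.linearCombination k M c) - Finsupp.linearCombination k M c₀ ∈
        maximalIdeal R ^ (s + 1) := by
      rw [hlc₀, Finsupp.linearCombination_apply, Finsupp.sum, map_sum, ← Finset.sum_sub_distrib]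
      refine Ideal.sum_mem _ fun J hJ => ?_
      rw [map_smul, ← smul_sub]
      exact Submodule.smul_of_tower_mem _ _ (operator_sub_mem hp hx hh hD hDm
        (by rw [sum_leadExp, hcr J hJ]; omega) (hlt J hJ))
    rw [map_sub] at h1
    simpa using add_mem h1 h2
  have hgI : D f ∈ I.level (a - (weight p e B : ℝ)) := by
    have := hDI I hI a f hf
    rwa [sum_leadExp] at this
  have hcard : c'.support.card < n := by
    rw [← hcn]
    refine Finset.card_lt_card (Finset.ssubset_iff_subset_ne.mpr ⟨?_, fun heq => ?_⟩)
    · rw [Finsupp.support_filter]; exact Finset.filter_subset _ _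
    · rw [← heq, Finsupp.support_filter, Finset.mem_filter] at hJ₁
      exact hJ₁.2 rfl
  have hc'r : ∀ J ∈ c'.support, ∑ i, J i = r := by
    intro J hJ
    rw [Finsupp.support_filter, Finset.mem_filter] at hJ
    exact hcr J hJ.1
  have hc₀s : ∀ J ∈ c₀.support, ∑ i, J i = s ∧ quotExp q J = 0 := by
    intro J hJ
    obtain ⟨J', hJ', rfl⟩ := Finset.mem_image.mp (Finsupp.mapDomain_support hJ)
    rw [Finsupp.support_filter, Finset.mem_filter] at hJ'
    refine ⟨?_, quotExp_remExp J'⟩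
    have := sum_remExp_add q J'
    rw [hJ'.2, hcr J' hJ'.1] at this
    omega
  -- If the required order exceeds s, the level a − |[B]| must be positive, and the condition on μ
  -- puts Df in 𝔪^{s+1} + (ℋ). Since c₀ is free of h and represents Df in degree s, it vanishes.
  have hdich : D f ∈ cutLevel I μ (a - (weight p e B : ℝ)) ∨ c₀ = 0 := by
    by_cases hn : ⌈μ * (a - (weight p e B : ℝ))⌉₊ ≤ s
    · left
      refine ⟨hgI, Ideal.pow_le_pow_right hn (hD r s f ?_ (by rw [sum_leadExp]; omega))⟩
      have h1 : Finsupp.linearCombination k M c ∈ maximalIdeal R ^ r := by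
        rw [Finsupp.linearCombination_apply]
        refine Ideal.sum_mem _ fun J hJ => Submodule.smul_of_tower_mem _ _ ?_
        rw [← hcr J hJ]
        exact normalMono_mem_pow hx.mem hh J
      simpa using add_mem (Ideal.pow_le_pow_right (Nat.le_succ r) hfc) h1
    · right
      have hpos : 0 < a - (weight p e B : ℝ) := by
        by_contra hle
        refine hn ?_
        rw [Nat.ceil_eq_zero.mpr (mul_nonpos_of_nonneg_of_nonpos hμ0 (not_lt.mp hle))]
        exact Nat.zero_le _
      refine hS.eq_zero_of_mem_sup hx hh hq c₀ hc₀s ?_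
      have h1 := pow_sup_le_pow_sup (maximalIdeal R) (Ideal.span (Set.range h))
        (show s + 1 ≤ ⌈μ * (a - (weight p e B : ℝ))⌉₊ by omega)
        (mem_pow_sup_of_lt_muMod hμ0 hμ hgI hpos)
      simpa using sub_mem h1 (Submodule.mem_sup_left hgc)
  rcases hdich with hcut | hzero
  · have hmem : D f * mono h B ∈ (⨆ B : Fin N → ℕ,
        cutLevel I μ (a - (weight p e B : ℝ)) * Ideal.span {mono h B}) :=
      Submodule.mem_iSup_of_mem B (Ideal.mul_mem_mul hcut (Ideal.mem_span_singleton_self _))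
    have hmI : D f * mono h B ∈ I.level a := by
      have := I.level_mul_le _ _ (Ideal.mul_mem_mul hgI (I.mono_mem_level hHI B))
      rwa [show a - (weight p e B : ℝ) + ((∑ l, B l * p ^ e l : ℕ) : ℝ) = a by
        rw [weight]; ring] at this
    -- Subtracting Df · H^B stays in 𝕀_a and cancels the terms of cB, among them J₁.
    have hrec := ih _ hcard c' rfl hc'r (f - D f * mono h B) (sub_mem hf hmI) (by
      have h1 := Ideal.mul_mem_mul (mono_mem_pow_of_sub hx.mem hh B) hgc
      rw [← pow_add, mul_sub, hmul] at h1
      have h2 := sub_mem hfc (show mono h B * D f - Finsupp.linearCombination k M cB ∈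
        maximalIdeal R ^ (r + 1) by convert h1 using 2; omega)
      rw [← hcadd, map_add] at h2
      convert h2 using 1
      ring)
    simpa using add_mem hrec (Submodule.mem_sup_left hmem)
  -- With c₀ = 0 the combination given by cB is also zero, so c' already represents the leading form
  -- of f.
  · refine ih _ hcard c' rfl hc'r f hf ?_
    rw [hzero, map_zero, mul_zero] at hmul
    rwa [← hcadd, map_add, ← hmul, zero_add] at hfc

end

/-! ### Krull's intersection theorem and the conclusion -/

theorem mem_of_forall_mem_sup_pow {R : Type v} [CommRing R] [IsLocalRing R] [IsNoetherianRing R]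
    (J : Ideal R) {f : R} (hf : ∀ n, f ∈ J ⊔ maximalIdeal R ^ n) : f ∈ J := by
  rw [← Ideal.Quotient.eq_zero_iff_mem]
  refine IsHausdorff.haus (I := maximalIdeal R) (M := R ⧸ J) inferInstance _ fun n => ?_
  rw [SModEq.zero]
  obtain ⟨a, ha, b, hb, rfl⟩ := Submodule.mem_sup.mp (hf n)
  rw [map_add, Ideal.Quotient.eq_zero_iff_mem.mpr ha, zero_add]
  have := Submodule.smul_mem_smul hb (Submodule.mem_top (x := (1 : R ⧸ J)))
  rwa [Algebra.smul_def, mul_one] at this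

end Kawanoue

theorem lemma4p1p4p1 {k : Type u} {R : Type v} [Field k] [IsAlgClosed k] (p : ℕ) [ExpChar k p]
    [CommRing R] [IsLocalRing R] [Algebra k R]
    (hR : Kawanoue.IsLocalRingAtClosedPoint k R ∨ Kawanoue.IsCompletedLocalRingAtClosedPoint k R)
    (I : Kawanoue.IdealisticFiltration R) (hI : I.IsDSaturated k)
    {N : ℕ} (h : Fin N → R) (e : Fin N → ℕ) (hH : Kawanoue.IsPureSystem k p h e)
    (hHI : ∀ l, h l ∈ I.level (p ^ e l : ℕ))
    (μ : ℝ) (hμ0 : 0 ≤ μ) (hμ : ENNReal.ofReal μ < Kawanoue.muMod h I) (a : ℝ) :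
    I.level a = ⨆ B : Fin N → ℕ,
      Kawanoue.cutLevel I μ (a - (Kawanoue.weight p e B : ℝ)) *
        Ideal.span {∏ l, h l ^ B l} := by
  have hS : Kawanoue.IsHasseSmooth k R := hR.elim (·.isHasseSmooth) (·.isHasseSmooth)
  have := hS.isNoetherianRing
  have hp : ExpChar R p := expChar_of_injective_algebraMap (algebraMap k R).injective p
  obtain ⟨y, hy, hhy, hind⟩ := hH.exists_roots
  obtain ⟨d, z, hx⟩ := hS.exists_isCoordinates y hy hind
  have hge : (⨆ B : Fin N → ℕ, Kawanoue.cutLevel I μ (a - (Kawanoue.weight p e B : ℝ)) *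
      Ideal.span {∏ l, h l ^ B l}) ≤ I.level a := by
    refine iSup_le fun B => ?_
    have hB : Ideal.span {∏ l, h l ^ B l} ≤ I.level (Kawanoue.weight p e B : ℝ) :=
      (Ideal.span_singleton_le_iff_mem _).mpr (I.mono_mem_level hHI B)
    refine (Ideal.mul_mono inf_le_left hB).trans ((I.level_mul_le _ _).trans ?_)
    rw [sub_add_cancel]
  refine le_antisymm (fun f hf => Kawanoue.mem_of_forall_mem_sup_pow _ fun n => ?_) hge
  induction n with
  | zero => simp
  | succ n ih =>
    obtain ⟨g, hg, b, hb, rfl⟩ := Submodule.mem_sup.mp ih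
    -- The remainder of order n stays in 𝕀_a because the sum is contained in 𝕀_a, so the elimination
    -- applies again in degree n.
    have hbI : b ∈ I.level a := by simpa using sub_mem hf (hge hg)
    obtain ⟨w, hw, b', hb', hwb⟩ := Submodule.mem_sup.mp
      (hS.mem_span_normalMono (q := fun l => p ^ e l) (h := h) hx hhy n b hb)
    obtain ⟨c, hc, rfl⟩ := (Finsupp.mem_span_image_iff_linearCombination k).mp hw
    refine add_mem (Submodule.mem_sup_left hg) ?_
    refine hS.mem_iSup_sup hp hx hhy hI hHI hμ0 hμ a n _ c rfl (fun J hJ => hc hJ) b hbI ?_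
    rw [← hwb, add_sub_cancel_left]
    exact hb'
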